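/- Fix a field $K$ and an integer $d\ge 1$. A $d$-uniform clutter $\mathcal C$ on $[n]=\{1,\dots,n\}$ is a set of $d$-subsets of $[n]$, called circuits; a subclutter is a subset of $\mathcal C$. A submaximal circuit of $\mathcal C$ is a $(d-1)$-subset $e$ contained in some circuit, and its degree is the number of circuits containing $e$. $\mathcal C$ is connected if any two vertices lying in circuits of $\mathcal C$ are joined by a sequence of circuits in which consecutive circuits meet. $\mathcal C$ is a tree if it is nonempty and connected and every nonempty subclutter of $\mathcal C$ has a submaximal circuit of degree one. A clique of $\mathcal C$ is a subset of $[n]$ all of whose $d$-subsets are circuits (so every set with fewer than $d$ elements is a clique); the clique complex $\Delta(\mathcal C)$ is the simplicial complex generated by the cliques. Let $\bar{\mathcal C}$ be the set of $d$-subsets of $[n]$ that are not in $\mathcal C$, and let $I(\bar{\mathcal C})\subset K[x_1,\dots,x_n]$ be the circuit ideal of $\mathcal C$, generated by the monomials $\prod_{i\in T}x_i$, $T\in\bar{\mathcal C}$. A nonzero homogeneous ideal has a $d$-linear resolution if its Castelnuovo–Mumford regularity and its initial degree both equal $d$; the zero ideal has a $d$-linear resolution by convention. Suppose that $I(\bar{\mathcal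 C})$ has no $d$-linear resolution. Then $\mathcal C$ is called minimal to $d$-linearity if $I(\overline{\mathcal C'})$ has a $d$-linear resolution for every $\mathcal C'\subsetneq\mathcal C$, and $\dim\Delta(\mathcal C)=d-1$; it is called almost tree if every nonempty $\mathcal C'\subsetneq\mathcal C$ is a tree; and it is called almost tree in the wide sense (where connectedness of the subclutters is not required) if every nonempty $\mathcal C'\subsetneq\mathcal C$ has a submaximal circuit of degree one. Let $\mathscr C^{\min}_d$, $\mathscr C^{\rm a.tree}_d$ and $\mathscr C^{\rm a.tree,w}_d$ be the classes of $d$-uniform clutters (on any $[n]$, $n \ge 0$) that are, respectively, minimal to $d$-linearity, almost tree, and almost tree in the wide sense. **Lemma.** If a $d$-uniform clutter $\mathcal C$ is a tree, or almost tree, or almost tree in the wide sense, then $\dim\Delta(\mathcal C)=d-1$. In particular, $\mathscr C^{\rm a.tree}_d\subseteq\mathscr C^{\min}_d$, and also $\mathscr C^{\rm a.tree,w}_d\subseteq\mathscr C^{\min}_d$. -/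

import Mathlib

/-! ### Graded free resolutions of ideals of `K[x_1, …, x_n]` -/

/-- A minimal graded free resolution
`⋯ → F_2 → F_1 → F_0 → I → 0` of an ideal `I` of the standard graded polynomial ring
`S = K[x_1, …, x_n]`, written in homogeneous bases: `F_i` is the free module with basis
`Fin (rank i)`, the `k`-th basis element being of degree `deg i k`
(so that `F_i = ⨁_k S(-deg i k)`). -/
structure MinimalGradedFreeResolution {K : Type*} [Field K] {n : ℕ}
    (I : Ideal (MvPolynomial (Fin n) K)) where
  rank : ℕ → ℕ
  deg : (i : ℕ) → Fin (rank i) → ℕ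
  /-- the images in `I` of the basis elements of `F_0` -/
  gen : Fin (rank 0) → MvPolynomial (Fin n) K
  /-- the matrix of the differential `F_{i+1} → F_i` -/
  diff : (i : ℕ) → Matrix (Fin (rank i)) (Fin (rank (i + 1))) (MvPolynomial (Fin n) K)
  /-- the augmentation `F_0 → I` preserves degrees -/
  gen_homogeneous : ∀ k, (gen k).IsHomogeneous (deg 0 k)
  /-- the differentials preserve degrees: the `(a, b)` entry is homogeneous of degree
  `deg (i+1) b - deg i a` (and is zero if this number is negative) -/
  diff_homogeneous : ∀ i a b, ∀ m ∈ (diff i a b).support, m.degree + deg i a = deg (i + 1) b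
  /-- exactness at `I` -/
  span_gen : Ideal.span (Set.range gen) = I
  /-- exactness at `F_0` -/
  exact_zero : Function.Exact (fun v => (diff 0).mulVec v) (fun v => ∑ k, v k * gen k)
  /-- exactness at `F_{i+1}` -/
  exact_succ : ∀ i, Function.Exact (fun v => (diff (i + 1)).mulVec v)
    (fun v => (diff i).mulVec v)
  /-- minimality: all entries of the differentials lie in `(x_1, …, x_n)` -/
  minimal : ∀ i a b, MvPolynomial.constantCoeff (diff i a b) = 0

/-- The graded Betti number `β_{i,j}`: the number of summands `S(-j)` of `F_i` in the minimal
graded free resolution. -/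
def MinimalGradedFreeResolution.betti {K : Type*} [Field K] {n : ℕ}
    {I : Ideal (MvPolynomial (Fin n) K)} (R : MinimalGradedFreeResolution I) (i j : ℕ) : ℕ :=
  (Finset.univ.filter fun k : Fin (R.rank i) => R.deg i k = j).card

/-- `reg I = r`, that is, `sup {j - i : β_{i,j}(I) ≠ 0} = r`
(the minimal graded free resolution is unique up to isomorphism). -/
def HasRegularity {K : Type*} [Field K] {n : ℕ} (I : Ideal (MvPolynomial (Fin n) K))
    (r : ℤ) : Prop :=
  ∃ R : MinimalGradedFreeResolution I,
    IsLUB {x : ℤ | ∃ i j : ℕ, R.betti i j ≠ 0 ∧ x = (j : ℤ) - (i : ℤ)} r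

/-- `indeg I = r`: the least degree in which the homogeneous ideal `I` has a nonzero element. -/
def HasInitialDegree {K : Type*} [Field K] {n : ℕ} (I : Ideal (MvPolynomial (Fin n) K))
    (r : ℕ) : Prop :=
  IsLeast {i : ℕ | ∃ f ∈ I, f ≠ 0 ∧ f.IsHomogeneous i} r

/-- `I` has a `d`-linear resolution: `reg I = d = indeg I`. The zero ideal, whose regularity and
initial degree are not defined and all of whose Betti numbers vanish, has a `d`-linear resolution
by convention. -/
def HasLinearResolution {K : Type*} [Field K] {n : ℕ} (d : ℕ)
    (I : Ideal (MvPolynomial (Fin n) K)) : Prop :=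
  I = ⊥ ∨ (HasRegularity I (d : ℤ) ∧ HasInitialDegree I d)

/-! ### Uniform clutters -/

/-- A `d`-uniform clutter on the vertex set `[n]`: a set of `d`-subsets of `[n]`, the circuits.
(Distinct sets of the same size are never contained in one another.) Subclutters of `C` are the
clutters whose circuits are among those of `C`. -/
@[ext] structure UniformClutter (n d : ℕ) where
  circuits : Finset (Finset (Fin n))
  card_eq : ∀ F ∈ circuits, F.card = d

/-- The dimension of a simplicial complex, given by its finite nonempty set of faces: the maximum
of `|F| - 1` over the faces `F`. -/
def complexDim {n : ℕ} (faces : Finset (Finset (Fin n))) : ℤ :=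
  ((faces.sup Finset.card : ℕ) : ℤ) - 1

namespace UniformClutter

/-- The complement: all `d`-subsets of `[n]` that are not circuits. -/
def compl {n d : ℕ} (C : UniformClutter n d) : UniformClutter n d where
  circuits := Finset.powersetCard d Finset.univ \ C.circuits
  card_eq := fun F hF => by
    simp only [Finset.mem_sdiff, Finset.mem_powersetCard] at hF
    exact hF.1.2

/-- The ideal `I(C)` generated by the monomials `x_T`, `T` a circuit of `C`. -/
noncomputable def ideal (K : Type*) [Field K] {n d : ℕ} (C : UniformClutter n d) :
    Ideal (MvPolynomial (Fin n) K) :=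
  Ideal.span {f | ∃ T ∈ C.circuits, f = ∏ v ∈ T, MvPolynomial.X v}

/-- The circuit ideal of `C`, the ideal of the complement of `C`. -/
noncomputable def circuitIdeal (K : Type*) [Field K] {n d : ℕ} (C : UniformClutter n d) :
    Ideal (MvPolynomial (Fin n) K) :=
  C.compl.ideal K

/-- `V` is a clique of `C` if all `d`-subsets of `V` are circuits. In particular every set with
fewer than `d` elements is a clique. -/
def IsClique {n d : ℕ} (C : UniformClutter n d) (V : Finset (Fin n)) : Prop :=
  ∀ F ⊆ V, F.card = d → F ∈ C.circuits

open Classical in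
/-- (The set of faces of) the clique complex, the simplicial complex generated by the cliques. -/
noncomputable def cliqueComplex {n d : ℕ} (C : UniformClutter n d) :
    Finset (Finset (Fin n)) :=
  Finset.univ.filter fun F => ∃ V, C.IsClique V ∧ F ⊆ V

/-- `e` is a submaximal circuit: a `(d-1)`-subset contained in a circuit. -/
def IsSubmaximal {n d : ℕ} (C : UniformClutter n d) (e : Finset (Fin n)) : Prop :=
  e.card = d - 1 ∧ ∃ F ∈ C.circuits, e ⊆ F

/-- The degree of a submaximal circuit: the number of circuits that contain it. -/
def degree {n d : ℕ} (C : UniformClutter n d) (e : Finset (Fin n)) : ℕ :=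
  (C.circuits.filter fun F => e ⊆ F).card

/-- `C` has a submaximal circuit of degree one. -/
def HasDegreeOne {n d : ℕ} (C : UniformClutter n d) : Prop :=
  ∃ e, C.IsSubmaximal e ∧ C.degree e = 1

/-- `C` is connected: any two vertices of (circuits of) `C` are joined by a sequence of circuits
in which consecutive circuits meet. -/
def IsConnected {n d : ℕ} (C : UniformClutter n d) : Prop :=
  ∀ F₁ ∈ C.circuits, ∀ v₁ ∈ F₁, ∀ F₂ ∈ C.circuits, ∀ v₂ ∈ F₂,
    ∃ G₁ ∈ C.circuits, ∃ G₂ ∈ C.circuits, v₁ ∈ G₁ ∧ v₂ ∈ G₂ ∧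
      Relation.ReflTransGen
        (fun A B => A ∈ C.circuits ∧ B ∈ C.circuits ∧ (A ∩ B).Nonempty) G₁ G₂

/-- A tree: a (nonempty) connected clutter all of whose (nonempty) subclutters have a submaximal
circuit of degree one. -/
def IsTree {n d : ℕ} (C : UniformClutter n d) : Prop :=
  C.circuits.Nonempty ∧ C.IsConnected ∧
    ∀ C' : UniformClutter n d, C'.circuits ⊆ C.circuits → C'.circuits.Nonempty → C'.HasDegreeOne

/-- `C` is an obstruction to `d`-linearity (over the field `K`). -/
def IsObstruction (K : Type*) [Field K] {n d : ℕ} (C : UniformClutter n d) : Prop :=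
  ¬ HasLinearResolution d (C.circuitIdeal K) ∧
    ∀ C' : UniformClutter n d, C'.circuits ⊂ C.circuits →
      HasLinearResolution d (C'.circuitIdeal K)

/-- `C` is minimal to `d`-linearity (over the field `K`). -/
def IsMinimal (K : Type*) [Field K] {n d : ℕ} (C : UniformClutter n d) : Prop :=
  C.IsObstruction K ∧ complexDim C.cliqueComplex = (d : ℤ) - 1

/-- `C` is almost tree (over the field `K`): its circuit ideal has no `d`-linear resolution and
every proper (nonempty) subclutter is a tree. -/
def IsAlmostTree (K : Type*) [Field K] {n d : ℕ} (C : UniformClutter n d) : Prop :=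
  ¬ HasLinearResolution d (C.circuitIdeal K) ∧
    ∀ C' : UniformClutter n d, C'.circuits ⊂ C.circuits → C'.circuits.Nonempty → C'.IsTree

/-- The more inclusive reading of almost tree, in which the proper subclutters need not be
connected: the circuit ideal has no `d`-linear resolution and every proper (nonempty) subclutter
has a submaximal circuit of degree one. -/
def IsAlmostTreeWide (K : Type*) [Field K] {n d : ℕ} (C : UniformClutter n d) : Prop :=
  ¬ HasLinearResolution d (C.circuitIdeal K) ∧
    ∀ C' : UniformClutter n d, C'.circuits ⊂ C.circuits → C'.circuits.Nonempty → C'.HasDegreeOne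

/-- The class of `d`-uniform clutters (on any `[n]`) that are minimal to `d`-linearity. -/
def minimalClass (K : Type*) [Field K] (d : ℕ) : Set (Σ n : ℕ, UniformClutter n d) :=
  {C | C.2.IsMinimal K}

/-- The class of `d`-uniform clutters (on any `[n]`) that are almost tree. -/
def almostTreeClass (K : Type*) [Field K] (d : ℕ) : Set (Σ n : ℕ, UniformClutter n d) :=
  {C | C.2.IsAlmostTree K}

/-- The class of `d`-uniform clutters (on any `[n]`) that are almost tree in the more inclusive
sense. -/
def almostTreeWideClass (K : Type*) [Field K] (d : ℕ) : Set (Σ n : ℕ, UniformClutter n d) :=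
  {C | C.2.IsAlmostTreeWide K}

end UniformClutter

/-! The main point is that a clutter $\mathcal C$ has a circuit ideal with a $d$-linear resolution
as soon as every nonempty subclutter has a submaximal circuit of degree one. This is proved by
writing down the resolution.

By Hochster's formula the linear strand of $I(\bar{\mathcal C})$ should have, in homological degree
$i$, a basis counted by $\tilde H^{d-2}(\Delta(\mathcal C)_W)$ for $|W|=d+i$. As $\Delta(\mathcal
C)$ contains every set of size less than $d$, this group is the space of simplicial $(d-1)$-cocycles
on the full simplex $W$ that vanish on the circuits. `cocycleModule` collects these spaces for all
$W$, `cocycleD` is the Koszul-type differential between them and `cocycleAug` the map to the ideal.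
If this complex is exact (`IsCocycleAcyclic`), it is a minimal linear resolution
(`IsCocycleAcyclic.exists_resolution`).

Exactness is controlled one circuit at a time. Let $F=e\cup\{f\}$ become a circuit. Evaluating
cocycles at $F$ maps the complex of $\mathcal C$ to functions of $W$, with the complex of $\mathcal
C\cup\{F\}$ as kernel. Under the conditions on $Q$ in `IsCocycleAcyclic.insert_circuit` the image is
the Koszul complex on the variables of $Q$, which is exact except at its end. Hence acyclicity
passes from $\mathcal C$ to $\mathcal C\cup\{F\}$, and also back when every other noncircuit meets
$Q$ (`IsCocycleAcyclic.of_insert_circuit`). Going back, from all $d$-sets down to none, settles the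
empty clutter; going forward along circuits with a degree-one face settles the clutters above.

For the dimension, a nonempty $\mathcal C$ with $\dim\Delta(\mathcal C)\ne d-1$ contains all
$d$-subsets of some $V$ with $|V|=d+1$. These form a subclutter without a submaximal circuit of
degree one, so $\mathcal C$ is not a tree, and in the almost tree case $\mathcal C$ is exactly this
subclutter. Then one forward step with $Q=V^c$ gives a linear resolution, a contradiction. -/

/-! ### Signs and cancellation in double sums. -/

/-- The sign of inserting `a` into `W`: minus one to the number of elements of `W` below `a`. -/
def insertSign {n : ℕ} (a : Fin n) (W : Finset (Fin n)) : ℤ := (-1) ^ (W.filter (· < a)).card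

theorem insertSign_mul_self {n : ℕ} (a : Fin n) (W : Finset (Fin n)) :
    insertSign a W * insertSign a W = 1 := by
  rw [insertSign, ← mul_pow]; simp

theorem insertSign_smul_eq_zero {n : ℕ} {M : Type*} [AddCommGroup M] (a : Fin n)
    (W : Finset (Fin n)) {x : M} (h : insertSign a W • x = 0) : x = 0 := by
  rw [← one_zsmul x, ← insertSign_mul_self a W, mul_zsmul, h, smul_zero]

theorem insertSign_insert_of_lt {n : ℕ} {a b : Fin n} {W : Finset (Fin n)} (ha : a ∉ W)
    (hab : a < b) : insertSign b (insert a W) = - insertSign b W := by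
  rw [insertSign, insertSign, Finset.filter_insert, if_pos hab, Finset.card_insert_of_notMem
    (by simp [ha]), pow_succ, mul_neg_one]

theorem insertSign_insert_of_le {n : ℕ} {a b : Fin n} {W : Finset (Fin n)}
    (hab : b ≤ a) : insertSign b (insert a W) = insertSign b W := by
  rw [insertSign, insertSign, Finset.filter_insert, if_neg hab.not_gt]

theorem insertSign_comm {n : ℕ} {a b : Fin n} {W : Finset (Fin n)} (ha : a ∉ W) (hb : b ∉ W)
    (hab : a ≠ b) :
    insertSign a W * insertSign b (insert a W) = - (insertSign b W * insertSign a (insert b W)) := by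
  rcases lt_or_gt_of_ne hab with h | h
  · rw [insertSign_insert_of_lt ha h, insertSign_insert_of_le h.le]; ring
  · rw [insertSign_insert_of_lt hb h, insertSign_insert_of_le h.le]; ring

/-- Swapping the two indices pairs off the terms. This yields $\partial^2=0$ both for the Koszul
differential and for the simplicial coboundary. -/
theorem Finset.sum_sum_erase_eq_zero {ι M : Type*} [DecidableEq ι] [AddCommMonoid M]
    (s : Finset ι) (f : ι → ι → M)
    (h : ∀ a ∈ s, ∀ b ∈ s, a ≠ b → f a b + f b a = 0) :
    ∑ a ∈ s, ∑ b ∈ s.erase a, f a b = 0 := by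
  rw [Finset.sum_sigma']
  refine Finset.sum_involution (fun p _ => ⟨p.2, p.1⟩) ?_ ?_ ?_ ?_
  · rintro ⟨a, b⟩ hp
    simp only [Finset.mem_sigma, Finset.mem_erase] at hp
    exact h a hp.1 b hp.2.2 (Ne.symm hp.2.1)
  · rintro ⟨a, b⟩ hp _ he
    simp only [Finset.mem_sigma, Finset.mem_erase] at hp
    simp only [Sigma.mk.injEq] at he
    exact hp.2.1 he.1
  · rintro ⟨a, b⟩ hp
    simp only [Finset.mem_sigma, Finset.mem_erase] at hp ⊢
    exact ⟨hp.2.2, Ne.symm hp.2.1, hp.1⟩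
  · rintro ⟨a, b⟩ _
    rfl

/-! ### Exactness of the Koszul complex on a set of variables. -/

section Koszul

open MvPolynomial

variable {K : Type*} [Field K] {n : ℕ}

/-- The Koszul differential on functions on the set of all subsets of the variables. -/
noncomputable def koszulD (k : Finset (Fin n) → MvPolynomial (Fin n) K) (W : Finset (Fin n)) :
    MvPolynomial (Fin n) K :=
  ∑ w ∈ Wᶜ, insertSign w W • (X w * k (insert w W))

theorem koszulD_sub (k l : Finset (Fin n) → MvPolynomial (Fin n) K) (W : Finset (Fin n)) :
    koszulD (fun W => k W - l W) W = koszulD k W - koszulD l W := by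
  simp only [koszulD, mul_sub, smul_sub, Finset.sum_sub_distrib]

theorem koszulD_add (k l : Finset (Fin n) → MvPolynomial (Fin n) K) (W : Finset (Fin n)) :
    koszulD (fun W => k W + l W) W = koszulD k W + koszulD l W := by
  simp only [koszulD, mul_add, smul_add, Finset.sum_add_distrib]

theorem koszulD_congr {k l : Finset (Fin n) → MvPolynomial (Fin n) K} {W : Finset (Fin n)}
    (h : ∀ w ∉ W, k (insert w W) = l (insert w W)) : koszulD k W = koszulD l W :=
  Finset.sum_congr rfl fun w hw => by rw [h w (by simpa using hw)]

theorem koszulD_koszulD (k : Finset (Fin n) → MvPolynomial (Fin n) K) (W : Finset (Fin n)) :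
    koszulD (koszulD k) W = 0 := by
  simp only [koszulD, Finset.mul_sum, Finset.smul_sum, Finset.compl_insert]
  refine Finset.sum_sum_erase_eq_zero Wᶜ (fun a b => insertSign a W •
    (X a * insertSign b (insert a W) • (X b * k (insert b (insert a W))))) fun a ha b hb hab => ?_
  rw [Finset.mem_compl] at ha hb
  simp only [mul_smul_comm, smul_smul]
  rw [insertSign_comm ha hb hab, Finset.insert_comm a b, mul_left_comm (X a) (X b), neg_smul,
    neg_add_cancel]

/-- A variable is a nonzerodivisor modulo an ideal generated by other variables. -/
theorem mem_span_X_of_X_mul_mem {s : Set (Fin n)} {a : Fin n} (ha : a ∉ s)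
    {p : MvPolynomial (Fin n) K} (h : X a * p ∈ Ideal.span (X '' s)) :
    p ∈ Ideal.span (X '' s : Set (MvPolynomial (Fin n) K)) := by
  rw [mem_ideal_span_X_image] at h ⊢
  intro m hm
  obtain ⟨i, hi, hmi⟩ := h (Finsupp.single a 1 + m) (by
    rw [mem_support_iff, mul_comm, add_comm, coeff_mul_X]; exact mem_support_iff.1 hm)
  refine ⟨i, hi, ?_⟩
  have : a ≠ i := fun h => ha (h ▸ hi)
  simpa [this.symm] using hmi

theorem mem_span_X_of_prod_mul_mem {s : Set (Fin n)} (F : Finset (Fin n)) (hF : ∀ a ∈ F, a ∉ s)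
    {p : MvPolynomial (Fin n) K} (h : (∏ v ∈ F, X v) * p ∈ Ideal.span (X '' s)) :
    p ∈ Ideal.span (X '' s : Set (MvPolynomial (Fin n) K)) := by
  induction F using Finset.induction_on with
  | empty => simpa using h
  | insert a F ha ih =>
    rw [Finset.prod_insert ha, mul_assoc] at h
    exact ih (fun b hb => hF b (Finset.mem_insert_of_mem hb))
      (mem_span_X_of_X_mul_mem (hF a (Finset.mem_insert_self a F)) h)

/-- The Koszul complex on the variables in `Q`, with subsets of `Q` shifted by a set `F` disjoint
from `Q`, is exact apart from the cokernel of its last differential. -/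
theorem exists_koszulD_eq (F Q : Finset (Fin n)) (hFQ : Disjoint F Q)
    (k : Finset (Fin n) → MvPolynomial (Fin n) K)
    (hk : ∀ W, k W ≠ 0 → F ⊆ W ∧ W ⊆ F ∪ Q)
    (hd : ∀ W, F ⊆ W → koszulD k W = 0)
    (h0 : k F ∈ Ideal.span (X '' (Q : Set (Fin n)))) :
    ∃ m : Finset (Fin n) → MvPolynomial (Fin n) K,
      (∀ W, m W ≠ 0 → F ⊆ W ∧ W ⊆ F ∪ Q) ∧ ∀ W, F ⊆ W → koszulD m W = k W := by
  induction Q using Finset.induction_on generalizing k with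
  | empty =>
    refine ⟨0, by simp, fun W hW => ?_⟩
    have hz : k F = 0 := by simpa using h0
    by_contra hne
    have hne' : k W ≠ 0 := by
      intro h; apply hne; rw [h]; simp [koszulD]
    have := (hk W hne')
    rw [Finset.union_empty] at this
    rw [this.2.antisymm this.1] at hne'
    exact hne' hz
  | insert q Q hq ih =>
    have hqF : q ∉ F := fun h => Finset.disjoint_left.1 hFQ h (Finset.mem_insert_self q Q)
    have hFQ' : Disjoint F Q := hFQ.mono_right (Finset.subset_insert q Q)
    have hqFQ : q ∉ F ∪ Q := by simp [hqF, hq]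
    -- the part of `k` on sets containing `q`
    obtain ⟨m₁, hm₁, hdm₁⟩ := ih hFQ'
      (fun W => if q ∈ W then 0 else insertSign q W • k (insert q W))
      (by
        intro W hW
        have hqW : q ∉ W := fun h => hW (if_pos h)
        have hW' : k (insert q W) ≠ 0 := by
          intro h; apply hW; simp [h]
        obtain ⟨h1, h2⟩ := hk _ hW'
        refine ⟨(Finset.subset_insert_iff_of_notMem hqF).1 h1, fun x hx => ?_⟩
        have := h2 (Finset.mem_insert_of_mem hx)
        have hxq : x ≠ q := fun h => hqW (h ▸ hx)
        simpa [hxq] using this)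
      (by
        intro W hW
        by_cases hqW : q ∈ W
        · refine Finset.sum_eq_zero fun w _ => ?_
          simp [hqW]
        · have h := hd (insert q W) (hW.trans (Finset.subset_insert q W))
          rw [koszulD, ← Finset.add_sum_erase _ _ (Finset.mem_compl.2 hqW)]
          rw [koszulD, Finset.compl_insert] at h
          simp only [Finset.mem_insert_self, if_true, mul_zero, smul_zero, zero_add]
          rw [← neg_eq_zero, ← smul_zero (insertSign q W), ← h, Finset.smul_sum,
            ← Finset.sum_neg_distrib]
          refine Finset.sum_congr rfl fun w hw => ?_
          rw [Finset.mem_erase, Finset.mem_compl] at hw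
          rw [if_neg (by simp [hw.1.symm, hqW]), mul_smul_comm, smul_smul, smul_smul,
            insertSign_comm hw.2 hqW hw.1, neg_smul, neg_neg, Finset.insert_comm])
      (by
        rw [if_neg hqF]
        refine zsmul_mem ?_ _
        -- The cycle equation at `F` puts `X q * k (insert q F)` into the ideal of `Q`, and `X q` is
        -- a nonzerodivisor modulo that ideal.
        have h := hd F le_rfl
        rw [koszulD, ← Finset.add_sum_erase _ _ (Finset.mem_compl.2 hqF)] at h
        have h2 : insertSign q F • (X q * k (insert q F)) ∈
            Ideal.span (X '' (Q : Set (Fin n)) : Set (MvPolynomial (Fin n) K)) := by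
          rw [eq_neg_of_add_eq_zero_left h]
          refine neg_mem (sum_mem fun w hw => zsmul_mem ?_ _)
          by_cases hz : k (insert w F) = 0
          · simp [hz]
          · have h3 := (hk _ hz).2 (Finset.mem_insert_self w F)
            rw [Finset.mem_erase, Finset.mem_compl] at hw
            have : w ∈ Q := by simpa [hw] using h3
            exact Ideal.mul_mem_right _ _ (Ideal.subset_span ⟨w, this, rfl⟩)
        have h4 := zsmul_mem h2 (insertSign q F)
        rw [smul_smul, insertSign_mul_self, one_zsmul] at h4
        exact mem_span_X_of_X_mul_mem (by simpa using hq) h4)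
    obtain ⟨b, hb⟩ : ∃ b, k F + X q * b ∈
        Ideal.span (X '' (Q : Set (Fin n)) : Set (MvPolynomial (Fin n) K)) := by
      rw [Finset.coe_insert, Set.image_insert_eq, Ideal.mem_span_insert] at h0
      obtain ⟨a, z, hz, h⟩ := h0
      exact ⟨-a, by rw [h]; convert hz using 1; ring⟩
    -- The value at `F` does not enter `koszulD` at any set containing `F`, so it is free to be
    -- chosen; `b` is the choice that puts the remaining end term into the ideal of `Q`.
    let m₂ := Function.update m₁ F b
    have hm₂F : m₂ F = b := Function.update_self ..
    have hm₂ : ∀ W, m₂ W ≠ 0 → F ⊆ W ∧ W ⊆ F ∪ Q := by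
      intro W hW
      by_cases h : W = F
      · rw [h]; exact ⟨le_rfl, Finset.subset_union_left⟩
      · rw [show m₂ W = m₁ W from Function.update_of_ne h ..] at hW
        exact hm₁ W hW
    have hqm₂ : ∀ W, q ∈ W → m₂ W = 0 := fun W hW => by
      by_contra h
      exact hqFQ ((hm₂ W h).2 hW)
    have hdm₂ : ∀ W, F ⊆ W → q ∉ W → koszulD m₂ W = insertSign q W • k (insert q W) := by
      intro W hW hqW
      rw [← if_neg (c := q ∈ W) (t := 0) (e := insertSign q W • k (insert q W)) hqW, ← hdm₁ W hW]
      refine koszulD_congr fun w hw => Function.update_of_ne ?_ ..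
      rintro rfl
      exact hw (hW (Finset.mem_insert_self w W))
    obtain ⟨m₀, hm₀, hdm₀⟩ := ih hFQ' (fun W => if q ∈ W then 0 else k W + X q * m₂ W)
      (by
        intro W hW
        have hqW : q ∉ W := fun h => hW (if_pos h)
        simp only [if_neg hqW] at hW
        by_cases h : m₂ W = 0
        · obtain ⟨h1, h2⟩ := hk W (by simpa [h] using hW)
          refine ⟨h1, fun x hx => ?_⟩
          have hxq : x ≠ q := fun h => hqW (h ▸ hx)
          simpa [hxq] using h2 hx
        · exact hm₂ W h)
      (by
        intro W hW
        by_cases hqW : q ∈ W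
        · exact Finset.sum_eq_zero fun w _ => by simp [hqW]
        · have h1 := hd W hW
          have h2 := hdm₂ W hW hqW
          rw [koszulD, ← Finset.add_sum_erase _ _ (Finset.mem_compl.2 hqW)] at h1 h2 ⊢
          rw [hqm₂ _ (Finset.mem_insert_self q W), mul_zero, smul_zero, zero_add] at h2
          simp only [Finset.mem_insert_self, if_true, mul_zero, smul_zero, zero_add]
          rw [← h1, ← mul_smul_comm, ← h2, add_comm, Finset.mul_sum, ← Finset.sum_add_distrib]
          refine Finset.sum_congr rfl fun w hw => ?_
          rw [Finset.mem_erase] at hw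
          rw [if_neg (by simp [hw.1.symm, hqW]), mul_add, smul_add, mul_smul_comm,
            mul_left_comm])
      (by rw [if_neg hqF, hm₂F]; exact hb)
    -- The complex on `insert q Q` is the mapping cone of multiplication by `X q` on the one for
    -- `Q`: `m₂` accounts for the sets containing `q`, and `m₀` for the others after correction by
    -- `X q * m₂`.
    refine ⟨fun W => m₀ W - if q ∈ W then insertSign q (W.erase q) • m₂ (W.erase q) else 0,
      fun W hW => ?_, fun W hW => ?_⟩
    · by_cases h : m₀ W = 0
      · simp only [h, zero_sub, neg_ne_zero, ne_eq, ite_eq_right_iff, Classical.not_imp] at hW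
        obtain ⟨h1, h2⟩ := hm₂ (W.erase q) (fun h => hW.2 (by rw [h, smul_zero]))
        refine ⟨h1.trans (Finset.erase_subset q W), fun x hx => ?_⟩
        by_cases hxq : x = q
        · simp [hxq]
        · have := h2 (Finset.mem_erase.2 ⟨hxq, hx⟩)
          rw [Finset.mem_union] at this ⊢
          exact this.imp id (Finset.mem_insert_of_mem)
      · obtain ⟨h1, h2⟩ := hm₀ W h
        exact ⟨h1, h2.trans (Finset.union_subset_union_right (Finset.subset_insert q Q))⟩
    · rw [koszulD_sub, hdm₀ W hW, sub_eq_iff_eq_add, eq_comm, ← eq_sub_iff_add_eq']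
      by_cases hqW : q ∈ W
      · have h := hdm₂ (W.erase q) (fun x hx => Finset.mem_erase.2 ⟨fun h => hqF (h ▸ hx), hW hx⟩)
          (Finset.notMem_erase q W)
        have hi := Finset.insert_erase hqW
        rw [hi, koszulD, Finset.compl_erase, Finset.sum_insert (by simp [hqW]),
          hi, hqm₂ W hqW, mul_zero, smul_zero, zero_add] at h
        rw [if_pos hqW, zero_sub, ← one_zsmul (k W), ← insertSign_mul_self q (W.erase q), mul_smul,
          ← h, koszulD, Finset.smul_sum, ← Finset.sum_neg_distrib]
        refine Finset.sum_congr rfl fun w hw => ?_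
        rw [Finset.mem_compl] at hw
        have hwq : w ≠ q := fun h => hw (h ▸ hqW)
        rw [if_pos (Finset.mem_insert_of_mem hqW), Finset.erase_insert_of_ne hwq]
        have hs := insertSign_comm (a := q) (b := w) (W := W.erase q) (Finset.notMem_erase q W)
          (fun h => hw (Finset.mem_of_mem_erase h)) hwq.symm
        rw [hi] at hs
        have hs1 := insertSign_mul_self w W
        have hs2 := insertSign_mul_self w (W.erase q)
        rw [mul_smul_comm, smul_smul, smul_smul, ← neg_smul]
        congr 1
        linear_combination (insertSign w W * insertSign w (W.erase q)) * hs
          - (insertSign q (W.erase q) * insertSign w (W.erase q)) * hs1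
          - (insertSign w W * insertSign q (insert w (W.erase q))) * hs2
      · rw [if_neg hqW, add_sub_cancel_left, koszulD,
          Finset.sum_eq_single_of_mem q (Finset.mem_compl.2 hqW)
          (fun w _ hwq => by simp [hwq.symm, hqW]), if_pos (Finset.mem_insert_self q W),
          Finset.erase_insert hqW, mul_smul_comm, smul_smul, insertSign_mul_self, one_zsmul]

end Koszul

/-! ### The complex of relative cocycles. -/

section CocycleComplex

open MvPolynomial

variable {K : Type*} [Field K] {n : ℕ}

/-- Functions `y` on pairs `(W, T)`, where `T` is a `d`-subset of `W` that is not in `C`, such that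
`y (W, ·)` is a simplicial cocycle on the full simplex `W` for every `W`. -/
def cocycleModule (R : Type*) [CommRing R] (d : ℕ) (C : Finset (Finset (Fin n))) :
    Submodule R (Finset (Fin n) × Finset (Fin n) → R) where
  carrier := {y | (∀ W T, y (W, T) ≠ 0 → T ⊆ W ∧ T.card = d ∧ T ∉ C) ∧
    ∀ W U, U ⊆ W → U.card = d + 1 →
      ∑ t ∈ U, insertSign t (U.erase t) • y (W, U.erase t) = 0}
  add_mem' := by
    rintro y z ⟨hy, hy'⟩ ⟨hz, hz'⟩
    refine ⟨fun W T h => ?_, fun W U hU hc => ?_⟩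
    · by_cases h0 : y (W, T) = 0
      · exact hz W T (by simpa [h0] using h)
      · exact hy W T h0
    · simp only [Pi.add_apply, smul_add, Finset.sum_add_distrib, hy' W U hU hc, hz' W U hU hc,
        add_zero]
  zero_mem' := by simp
  smul_mem' := by
    rintro c y ⟨hy, hy'⟩
    refine ⟨fun W T h => hy W T fun h0 => h (by simp [h0]), fun W U hU hc => ?_⟩
    simp only [Pi.smul_apply, smul_comm _ c, ← Finset.smul_sum, hy' W U hU hc, smul_zero]

/-- The defining equations have integer coefficients, so they can be checked on each monomial. This
is why a basis over the field will serve as a basis over the polynomial ring. -/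
theorem mem_cocycleModule_iff_coeff {d : ℕ} {C : Finset (Finset (Fin n))}
    {y : Finset (Fin n) × Finset (Fin n) → MvPolynomial (Fin n) K} :
    y ∈ cocycleModule (MvPolynomial (Fin n) K) d C ↔
      ∀ m, (fun p => coeff m (y p)) ∈ cocycleModule K d C := by
  constructor
  · rintro ⟨h1, h2⟩ m
    refine ⟨fun W T h => h1 W T fun h0 => h (by simp [h0]), fun W U hU hc => ?_⟩
    have := congrArg (coeff m) (h2 W U hU hc)
    simpa only [coeff_sum, coeff_smul, coeff_zero] using this
  · intro h
    refine ⟨fun W T h0 => ?_, fun W U hU hc => ?_⟩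
    · obtain ⟨m, hm⟩ := ne_zero_iff.1 h0
      exact (h m).1 W T hm
    · ext m
      simpa only [coeff_sum, coeff_smul, coeff_zero] using (h m).2 W U hU hc

theorem eq_zero_of_mem_cocycleModule {R : Type*} [CommRing R] {d : ℕ}
    {C : Finset (Finset (Fin n))} {y : Finset (Fin n) × Finset (Fin n) → R}
    (hy : y ∈ cocycleModule R d C) {W T : Finset (Fin n)}
    (h : T ⊆ W → T.card = d → T ∈ C) : y (W, T) = 0 := by
  by_contra h0
  obtain ⟨h1, h2, h3⟩ := hy.1 W T h0
  exact h3 (h h1 h2)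

theorem cocycleModule_anti {R : Type*} [CommRing R] {d : ℕ} {C C' : Finset (Finset (Fin n))}
    (h : C ⊆ C') : cocycleModule R d C' ≤ cocycleModule R d C :=
  fun _ hy => ⟨fun W T h0 => (hy.1 W T h0).imp id (And.imp id (mt (@h T))), hy.2⟩

theorem mem_cocycleModule_insert {R : Type*} [CommRing R] {d : ℕ} {C : Finset (Finset (Fin n))}
    {F : Finset (Fin n)} {y : Finset (Fin n) × Finset (Fin n) → R}
    (hy : y ∈ cocycleModule R d C) (h : ∀ W, F ⊆ W → y (W, F) = 0) :
    y ∈ cocycleModule R d (insert F C) := by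
  refine ⟨fun W T h0 => ?_, hy.2⟩
  obtain ⟨h1, h2, h3⟩ := hy.1 W T h0
  refine ⟨h1, h2, ?_⟩
  rw [Finset.mem_insert, not_or]
  refine ⟨?_, h3⟩
  rintro rfl
  exact h0 (h W h1)

/-- The differential, for each `T` that of the Koszul complex on the variables outside `T`. -/
noncomputable def cocycleD (y : Finset (Fin n) × Finset (Fin n) → MvPolynomial (Fin n) K) :
    Finset (Fin n) × Finset (Fin n) → MvPolynomial (Fin n) K :=
  fun p => if p.2 ⊆ p.1 then koszulD (fun W => y (W, p.2)) p.1 else 0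

theorem cocycleD_apply (y : Finset (Fin n) × Finset (Fin n) → MvPolynomial (Fin n) K)
    {W T : Finset (Fin n)} (h : T ⊆ W) :
    cocycleD y (W, T) = koszulD (fun W => y (W, T)) W := if_pos h

theorem cocycleD_sub (y z : Finset (Fin n) × Finset (Fin n) → MvPolynomial (Fin n) K) :
    cocycleD (y - z) = cocycleD y - cocycleD z := by
  ext1 p
  simp only [cocycleD, Pi.sub_apply, koszulD_sub]
  split_ifs <;> simp

theorem cocycleD_add (y z : Finset (Fin n) × Finset (Fin n) → MvPolynomial (Fin n) K) :
    cocycleD (y + z) = cocycleD y + cocycleD z := by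
  ext1 p
  simp only [cocycleD, Pi.add_apply, koszulD_add]
  split_ifs <;> simp

theorem cocycleD_cocycleD (y : Finset (Fin n) × Finset (Fin n) → MvPolynomial (Fin n) K) :
    cocycleD (cocycleD y) = 0 := by
  ext1 ⟨W, T⟩
  by_cases h : T ⊆ W
  · rw [cocycleD_apply _ h, Pi.zero_apply, ← koszulD_koszulD (fun W => y (W, T)) W]
    exact koszulD_congr fun w _ => cocycleD_apply _ (h.trans (Finset.subset_insert w W))
  · exact if_neg h

theorem cocycleD_mem {d : ℕ} {C : Finset (Finset (Fin n))}
    {y : Finset (Fin n) × Finset (Fin n) → MvPolynomial (Fin n) K}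
    (hy : y ∈ cocycleModule (MvPolynomial (Fin n) K) d C) :
    cocycleD y ∈ cocycleModule (MvPolynomial (Fin n) K) d C := by
  refine ⟨fun W T h => ?_, fun W U hU hc => ?_⟩
  · have hTW : T ⊆ W := by
      by_contra h0
      exact h (if_neg h0)
    rw [cocycleD_apply _ hTW] at h
    obtain ⟨w, _, hw⟩ := Finset.exists_ne_zero_of_sum_ne_zero h
    refine ⟨hTW, (hy.1 (insert w W) T fun h0 => hw ?_).2⟩
    simp [h0]
  · have : ∀ t ∈ U, insertSign t (U.erase t) • cocycleD y (W, U.erase t) =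
        ∑ w ∈ Wᶜ, insertSign w W • (X w *
          (insertSign t (U.erase t) • y (insert w W, U.erase t))) := by
      intro t _
      rw [cocycleD_apply _ ((Finset.erase_subset t U).trans hU), koszulD, Finset.smul_sum]
      exact Finset.sum_congr rfl fun w _ => by rw [mul_smul_comm, smul_comm]
    rw [Finset.sum_congr rfl this, Finset.sum_comm]
    refine Finset.sum_eq_zero fun w _ => ?_
    rw [← Finset.smul_sum, ← Finset.mul_sum,
      hy.2 (insert w W) U (hU.trans (Finset.subset_insert w W)) hc, mul_zero, smul_zero]

/-- The augmentation, which sends the basis vector at `(T, T)` to the monomial of `T`. -/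
noncomputable def cocycleAug (y : Finset (Fin n) × Finset (Fin n) → MvPolynomial (Fin n) K) :
    MvPolynomial (Fin n) K :=
  ∑ T : Finset (Fin n), (∏ v ∈ T, X v) * y (T, T)

theorem cocycleAug_sub (y z : Finset (Fin n) × Finset (Fin n) → MvPolynomial (Fin n) K) :
    cocycleAug (y - z) = cocycleAug y - cocycleAug z := by
  simp only [cocycleAug, Pi.sub_apply, mul_sub, Finset.sum_sub_distrib]

/-- Grouping the terms by $U=T\cup\{w\}$, the coefficient of $x_U$ is the cocycle condition of
$y(U,\cdot)$ on $U$ itself. -/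
theorem cocycleAug_cocycleD {d : ℕ} {C : Finset (Finset (Fin n))}
    {y : Finset (Fin n) × Finset (Fin n) → MvPolynomial (Fin n) K}
    (hy : y ∈ cocycleModule (MvPolynomial (Fin n) K) d C) :
    cocycleAug (cocycleD y) = 0 := by
  have h1 : cocycleAug (cocycleD y) = ∑ U : Finset (Fin n), ∑ t ∈ U,
      insertSign t (U.erase t) • ((∏ v ∈ U, X v) * y (U, U.erase t)) := by
    simp only [cocycleAug, cocycleD_apply _ (Finset.Subset.refl _), koszulD, Finset.mul_sum]
    rw [Finset.sum_sigma', Finset.sum_sigma']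
    refine Finset.sum_bij' (fun p _ => ⟨insert p.2 p.1, p.2⟩) (fun p _ => ⟨p.1.erase p.2, p.2⟩)
      ?_ ?_ ?_ ?_ ?_
    · rintro ⟨T, w⟩ _
      simp
    · rintro ⟨U, t⟩ _
      simp
    · rintro ⟨T, w⟩ h
      simp only [Finset.mem_sigma, Finset.mem_compl] at h
      simp [Finset.erase_insert h.2]
    · rintro ⟨U, t⟩ h
      simp only [Finset.mem_sigma] at h
      simp [Finset.insert_erase h.2]
    · rintro ⟨T, w⟩ h
      simp only [Finset.mem_sigma, Finset.mem_compl] at h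
      simp only [Finset.erase_insert h.2, Finset.prod_insert h.2, mul_smul_comm]
      rw [mul_left_comm, mul_assoc]
  rw [h1]
  refine Finset.sum_eq_zero fun U _ => ?_
  simp only [← mul_smul_comm, ← Finset.mul_sum]
  by_cases hU : U.card = d + 1
  · rw [hy.2 U U le_rfl hU, mul_zero]
  · rw [Finset.sum_eq_zero fun t ht => ?_, mul_zero]
    rw [eq_zero_of_mem_cocycleModule hy fun _ hc => ?_, smul_zero]
    exact absurd (by rw [← Finset.card_erase_add_one ht, hc]) hU

/-- The cocycle complex of `C` is exact apart from the cokernel of the augmentation. -/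
def IsCocycleAcyclic (K : Type*) [Field K] (d : ℕ) (C : Finset (Finset (Fin n))) : Prop :=
  ∀ y ∈ cocycleModule (MvPolynomial (Fin n) K) d C, cocycleD y = 0 → cocycleAug y = 0 →
    ∃ u ∈ cocycleModule (MvPolynomial (Fin n) K) d C, (∀ T, u (T, T) = 0) ∧ cocycleD u = y

/-- The entries at $(T,T)$ are read neither by `cocycleD`, which only looks at sets strictly larger
than some $W\supseteq T$, nor by the cocycle conditions, where $U\subseteq W$ is larger than $T$. -/
theorem exists_diagonal_eq_zero {d : ℕ} {C : Finset (Finset (Fin n))}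
    {u : Finset (Fin n) × Finset (Fin n) → MvPolynomial (Fin n) K}
    (hu : u ∈ cocycleModule (MvPolynomial (Fin n) K) d C) :
    ∃ u' ∈ cocycleModule (MvPolynomial (Fin n) K) d C,
      (∀ T, u' (T, T) = 0) ∧ cocycleD u' = cocycleD u := by
  refine ⟨fun p => if p.1 = p.2 then 0 else u p, ⟨fun W T h => ?_, fun W U hU hc => ?_⟩,
    fun T => if_pos rfl, ?_⟩
  · exact hu.1 W T fun h0 => h (by simp [h0])
  · refine (Finset.sum_congr rfl fun t ht => ?_).trans (hu.2 W U hU hc)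
    refine congrArg _ (if_neg fun (h : W = U.erase t) => ?_)
    exact Finset.notMem_erase t U (h ▸ hU ht)
  · ext1 ⟨W, T⟩
    by_cases h : T ⊆ W
    · rw [cocycleD_apply _ h, cocycleD_apply _ h]
      refine koszulD_congr fun w hw => if_neg fun (h0 : insert w W = T) => ?_
      exact hw (h (h0 ▸ Finset.mem_insert_self w W))
    · exact (if_neg h).trans (if_neg h).symm

/-- The simplicial coboundary of the indicator function of `e`. -/
def faceCoboundary (e T : Finset (Fin n)) : ℤ :=
  ∑ t ∈ T, insertSign t (T.erase t) * if T.erase t = e then 1 else 0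

theorem faceCoboundary_insert {e : Finset (Fin n)} {f : Fin n} (hf : f ∉ e) :
    faceCoboundary e (insert f e) = insertSign f e := by
  rw [faceCoboundary, Finset.sum_eq_single_of_mem f (Finset.mem_insert_self f e) fun t _ htf => ?_]
  · rw [Finset.erase_insert hf, if_pos rfl, mul_one]
  · rw [if_neg, mul_zero]
    intro h
    apply hf
    rw [← h]
    simp [htf.symm]

theorem exists_of_faceCoboundary_ne_zero {e T : Finset (Fin n)} (h : faceCoboundary e T ≠ 0) :
    ∃ t ∉ e, T = insert t e := by
  obtain ⟨t, ht, h⟩ := Finset.exists_ne_zero_of_sum_ne_zero h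
  have he : T.erase t = e := by
    by_contra h0
    simp [h0] at h
  refine ⟨t, ?_, ?_⟩
  · rw [← he]; exact Finset.notMem_erase t T
  · rw [← he, Finset.insert_erase ht]

theorem sum_insertSign_mul_faceCoboundary (e U : Finset (Fin n)) :
    ∑ t ∈ U, insertSign t (U.erase t) * faceCoboundary e (U.erase t) = 0 := by
  simp only [faceCoboundary, Finset.mul_sum]
  refine Finset.sum_sum_erase_eq_zero U (fun a b => insertSign a (U.erase a) *
    (insertSign b ((U.erase a).erase b) * if (U.erase a).erase b = e then 1 else 0))
    fun a ha b hb hab => ?_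
  have h := insertSign_comm (a := a) (b := b) (W := (U.erase a).erase b) (by simp) (by simp) hab
  rw [Finset.insert_erase (Finset.mem_erase.2 ⟨hab.symm, hb⟩), Finset.erase_right_comm,
    Finset.insert_erase (Finset.mem_erase.2 ⟨hab, ha⟩)] at h
  rw [Finset.erase_right_comm (a := a)]
  linear_combination (if (U.erase b).erase a = e then 1 else 0) * h

/-! ### Comparing the complexes before and after one circuit is added. -/

section Step

variable {d : ℕ} {C : Finset (Finset (Fin n))} {e Q : Finset (Fin n)} {f : Fin n}

/-- The lift is `m W` times the coboundary of `e`, with a sign that makes its value at `insert f e`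
equal to `m W`. It lives on the sets $e\cup\{t\}$ with $t\in W\subseteq e\cup\{f\}\cup Q$, none of
which is in `C`. -/
theorem exists_lift_koszul (hf : f ∉ e) (hd : e.card + 1 = d) (hF : insert f e ∉ C)
    (hQ : ∀ v ∈ Q, insert v e ∉ C) (m : Finset (Fin n) → MvPolynomial (Fin n) K)
    (hm : ∀ W, m W ≠ 0 → insert f e ⊆ W ∧ W ⊆ insert f e ∪ Q) :
    ∃ y ∈ cocycleModule (MvPolynomial (Fin n) K) d C,
      ∀ W, insert f e ⊆ W → y (W, insert f e) = m W := by
  refine ⟨fun p => if p.2 ⊆ p.1 then (insertSign f e * faceCoboundary e p.2) • m p.1 else 0,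
    ⟨fun W T h => ?_, fun W U hU hc => ?_⟩, fun W hW => ?_⟩
  · have hTW : T ⊆ W := by
      by_contra h0
      exact h (if_neg h0)
    simp only [if_pos hTW] at h
    obtain ⟨t, ht, rfl⟩ := exists_of_faceCoboundary_ne_zero (e := e) (T := T)
      fun h0 => h (by simp only [h0, mul_zero, zero_smul])
    refine ⟨hTW, by rw [Finset.card_insert_of_notMem ht, hd], ?_⟩
    have := (hm W fun h0 => h (by rw [h0, smul_zero])).2 (hTW (Finset.mem_insert_self t e))
    rw [Finset.mem_union, Finset.mem_insert] at this
    rcases this with (rfl | h0) | h0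
    · exact hF
    · exact absurd h0 ht
    · exact hQ t h0
  · have : ∀ t ∈ U, insertSign t (U.erase t) • (if U.erase t ⊆ W then
        (insertSign f e * faceCoboundary e (U.erase t)) • m W else 0) =
        (insertSign f e * (insertSign t (U.erase t) * faceCoboundary e (U.erase t))) • m W := by
      intro t _
      rw [if_pos ((Finset.erase_subset t U).trans hU), smul_smul, mul_left_comm]
    rw [Finset.sum_congr rfl this, ← Finset.sum_smul, ← Finset.mul_sum,
      sum_insertSign_mul_faceCoboundary, mul_zero, zero_smul]
  · simp only [if_pos hW]
    rw [faceCoboundary_insert hf, insertSign_mul_self, one_smul]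

/-- If all `d`-subsets of `insert w F` except `F` are in `C`, then cocycles vanish at `F`. -/
theorem cocycle_eq_zero {F W : Finset (Fin n)} {w : Fin n} (hF : F.card = d) (hFW : F ⊆ W)
    (hwF : w ∉ F) (hw : w ∈ W) (h : ∀ T ⊆ insert w F, T.card = d → T ≠ F → T ∈ C)
    {y : Finset (Fin n) × Finset (Fin n) → MvPolynomial (Fin n) K}
    (hy : y ∈ cocycleModule (MvPolynomial (Fin n) K) d C) : y (W, F) = 0 := by
  have h1 := hy.2 W (insert w F) (Finset.insert_subset hw hFW)
    (by rw [Finset.card_insert_of_notMem hwF, hF])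
  rw [Finset.sum_eq_single_of_mem w (Finset.mem_insert_self w F) fun t ht htw => ?_,
    Finset.erase_insert hwF] at h1
  · exact insertSign_smul_eq_zero w F h1
  · rw [eq_zero_of_mem_cocycleModule hy fun _ hc => ?_, smul_zero]
    refine h _ (Finset.erase_subset _ _) hc ?_
    intro h0
    exact hwF (h0 ▸ Finset.mem_erase.2 ⟨htw.symm, Finset.mem_insert_self w F⟩)

/-- The part at `F` of a cocycle whose differential vanishes at `F` is the part at `F` of a
boundary. -/
theorem exists_cocycleD_apply_eq (hf : f ∉ e) (hd : e.card + 1 = d) (hF : insert f e ∉ C)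
    (hFQ : Disjoint (insert f e) Q) (hQ : ∀ v ∈ Q, insert v e ∉ C)
    (hQ' : ∀ w ∉ insert f e ∪ Q, ∀ T ⊆ insert w (insert f e), T.card = d → T ≠ insert f e → T ∈ C)
    {u : Finset (Fin n) × Finset (Fin n) → MvPolynomial (Fin n) K}
    (hu : u ∈ cocycleModule (MvPolynomial (Fin n) K) d C)
    (hdu : ∀ W, insert f e ⊆ W → cocycleD u (W, insert f e) = 0)
    (h0 : u (insert f e, insert f e) ∈ Ideal.span (X '' (Q : Set (Fin n)))) :
    ∃ z ∈ cocycleModule (MvPolynomial (Fin n) K) d C,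
      u - cocycleD z ∈ cocycleModule (MvPolynomial (Fin n) K) d (insert (insert f e) C) := by
  -- An element of `W` outside `insert f e ∪ Q` forces the value at `insert f e` to vanish, so these
  -- values form a Koszul cycle on `Q`.
  obtain ⟨m, hm, hdm⟩ := exists_koszulD_eq (insert f e) Q hFQ (fun W => u (W, insert f e))
    (fun W hW => ⟨(hu.1 _ _ hW).1, fun w hw => by
      by_contra hwQ
      refine hW (cocycle_eq_zero ?_ (hu.1 _ _ hW).1 ?_ hw (hQ' w hwQ) hu)
      · rw [Finset.card_insert_of_notMem hf, hd]
      · exact fun h => hwQ (Finset.mem_union_left Q h)⟩)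
    (fun W hW => by rw [← cocycleD_apply _ hW, hdu W hW]) h0
  obtain ⟨z, hz, hzm⟩ := exists_lift_koszul hf hd hF hQ m hm
  refine ⟨z, hz, mem_cocycleModule_insert (sub_mem hu (cocycleD_mem hz)) fun W hW => ?_⟩
  rw [Pi.sub_apply, cocycleD_apply _ hW, ← hdm W hW, sub_eq_zero]
  exact koszulD_congr fun w _ => (hzm _ (hW.trans (Finset.subset_insert w W))).symm

/-- A preimage `u` of `y` in the larger complex need not vanish at the new circuit, but its values
there form a Koszul cycle. Subtracting a boundary removes them without changing `cocycleD u`. -/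
theorem IsCocycleAcyclic.insert_circuit (hf : f ∉ e) (hd : e.card + 1 = d) (hF : insert f e ∉ C)
    (hFQ : Disjoint (insert f e) Q) (hQ : ∀ v ∈ Q, insert v e ∉ C)
    (hQ' : ∀ w ∉ insert f e ∪ Q, ∀ T ⊆ insert w (insert f e),
      T.card = d → T ≠ insert f e → T ∈ C)
    (hC : IsCocycleAcyclic K d C) : IsCocycleAcyclic K d (insert (insert f e) C) := by
  intro y hy hdy hay
  obtain ⟨u, hu, hu0, hdu⟩ := hC y (cocycleModule_anti (Finset.subset_insert _ C) hy) hdy hay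
  obtain ⟨z, hz, hzu⟩ := exists_cocycleD_apply_eq hf hd hF hFQ hQ hQ' hu
    (fun W hW => by
      rw [hdu]
      exact eq_zero_of_mem_cocycleModule hy fun _ _ => Finset.mem_insert_self _ C)
    (by rw [hu0]; exact zero_mem _)
  obtain ⟨u', hu', h0, hdu'⟩ := exists_diagonal_eq_zero hzu
  exact ⟨u', hu', h0, by rw [hdu', cocycleD_sub, hdu, cocycleD_cocycleD, sub_zero]⟩

/-- Here the cycle `y` itself is moved into the smaller complex. The condition `hCQ` handles the end
of the Koszul complex: it says that dividing the other generators by $x_F$ stays inside the ideal of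
$Q$, as for linear quotients. -/
theorem IsCocycleAcyclic.of_insert_circuit (hf : f ∉ e) (hd : e.card + 1 = d) (hF : insert f e ∉ C)
    (hFQ : Disjoint (insert f e) Q) (hQ : ∀ v ∈ Q, insert v e ∉ C)
    (hQ' : ∀ w ∉ insert f e ∪ Q, ∀ T ⊆ insert w (insert f e),
      T.card = d → T ≠ insert f e → T ∈ C)
    (hCQ : ∀ T ∉ C, T.card = d → T ≠ insert f e → ¬ Disjoint T Q)
    (hC : IsCocycleAcyclic K d (insert (insert f e) C)) :
    IsCocycleAcyclic K d C := by
  intro y hy hdy hay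
  obtain ⟨z, hz, hzy⟩ := exists_cocycleD_apply_eq hf hd hF hFQ hQ hQ' hy
    (fun W hW => by rw [hdy, Pi.zero_apply])
    (by
      -- In `cocycleAug y = 0` every term other than the one at `insert f e` is zero or divisible by
      -- a variable of `Q`; the variables of `insert f e` can then be cancelled.
      apply mem_span_X_of_prod_mul_mem (insert f e)
        (fun a ha => Finset.disjoint_left.1 hFQ ha)
      rw [cocycleAug, ← Finset.add_sum_erase _ _ (Finset.mem_univ (insert f e))] at hay
      rw [eq_neg_of_add_eq_zero_left hay]
      refine neg_mem (sum_mem fun T hT => ?_)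
      by_cases h0 : y (T, T) = 0
      · rw [h0, mul_zero]; exact zero_mem _
      · obtain ⟨_, h1, h2⟩ := hy.1 T T h0
        obtain ⟨v, hvT, hvQ⟩ := Finset.not_disjoint_iff.1 (hCQ T h2 h1 (Finset.mem_erase.1 hT).1)
        refine Ideal.mul_mem_right _ _ ?_
        rw [← Finset.mul_prod_erase T _ hvT]
        exact Ideal.mul_mem_right _ _ (Ideal.subset_span ⟨v, hvQ, rfl⟩))
  obtain ⟨u, hu, hu0, hdu⟩ := hC _ hzy
    (by rw [cocycleD_sub, hdy, cocycleD_cocycleD, sub_zero])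
    (by rw [cocycleAug_sub, hay, cocycleAug_cocycleD hz, sub_zero])
  obtain ⟨u', hu', h0, hdu'⟩ := exists_diagonal_eq_zero
    (add_mem (cocycleModule_anti (Finset.subset_insert _ C) hu) hz)
  exact ⟨u', hu', h0, by rw [hdu', cocycleD_add, hdu, sub_add_cancel]⟩

end Step

end CocycleComplex

/-! ### Acyclicity for the clutters that are needed. -/

section Acyclicity

variable {K : Type*} [Field K] {n d : ℕ}

/-- The noncircuits are turned into circuits one by one, largest maximum first, until the ideal is
zero. For $F$ with maximum $f$ the set $Q=\{v\notin F: v<f\}$ works: replacing $f$ by such a $v$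
lowers the maximum, a $d$-set containing some $w>f$ is already a circuit, and any other noncircuit
has an element in $Q$. -/
theorem isCocycleAcyclic_of_forall_sup_le (hd : 0 < d) (k : ℕ) (C : Finset (Finset (Fin n)))
    (hk : (Finset.powersetCard d Finset.univ \ C).card = k)
    (h : ∀ T ∉ C, T.card = d → ∀ G ∈ C, T.sup Fin.val ≤ G.sup Fin.val) :
    IsCocycleAcyclic K d C := by
  induction k generalizing C with
  | zero =>
    intro y hy _ _
    have h0 : y = 0 := by
      ext1 ⟨W, T⟩
      refine eq_zero_of_mem_cocycleModule hy fun _ hc => ?_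
      by_contra hT
      have : T ∈ Finset.powersetCard d Finset.univ \ C := by simp [hc, hT]
      rw [Finset.card_eq_zero.1 hk] at this
      exact Finset.notMem_empty T this
    refine ⟨0, zero_mem _, fun _ => rfl, ?_⟩
    rw [h0]
    ext1 p
    simp [cocycleD, koszulD]
  | succ k ih =>
    obtain ⟨F, hF, hmax⟩ := Finset.exists_max_image (Finset.powersetCard d Finset.univ \ C)
      (fun T => T.sup Fin.val) (Finset.card_pos.1 (by omega))
    have hF' := hF
    rw [Finset.mem_sdiff, Finset.mem_powersetCard] at hF'
    obtain ⟨⟨-, hFd⟩, hFC⟩ := hF'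
    obtain ⟨f, hf, hfs⟩ := Finset.exists_mem_eq_sup F (Finset.card_pos.1 (by omega)) Fin.val
    have hFe : insert f (F.erase f) = F := Finset.insert_erase hf
    have hle : ∀ t ∈ F, t ≤ f := fun t ht => by
      rw [Fin.le_def, ← hfs]; exact Finset.le_sup (f := Fin.val) ht
    have key : ∀ T ∉ C, T.card = d → ∀ t ∈ T, t ≤ f := fun T hT hTd t ht => by
      rw [Fin.le_def, ← hfs]
      exact (Finset.le_sup (f := Fin.val) ht).trans (hmax T (by simp [hT, hTd]))
    have hins : IsCocycleAcyclic K d (insert F C) := by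
      refine ih _ ?_ fun T hT hTd G hG => ?_
      · rw [Finset.sdiff_insert, Finset.card_erase_of_mem hF, hk, Nat.add_sub_cancel]
      · rw [Finset.mem_insert, not_or] at hT
        rcases Finset.mem_insert.1 hG with rfl | hG
        · exact hmax T (by simp [hT.2, hTd])
        · exact h T hT.2 hTd G hG
    rw [← hFe] at hins hFC
    refine IsCocycleAcyclic.of_insert_circuit (Q := Finset.univ.filter fun v => v ∉ F ∧ v < f)
      (Finset.notMem_erase f F) (by rw [Finset.card_erase_add_one hf, hFd]) hFC ?_ ?_ ?_ ?_ hins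
    · rw [hFe, Finset.disjoint_left]
      intro a ha
      simp [ha]
    · intro v hv hvC
      simp only [Finset.mem_filter, Finset.mem_univ, true_and] at hv
      have h1 := h F (hFe ▸ hFC) hFd _ hvC
      rw [hfs] at h1
      refine absurd h1 (not_le.2 ?_)
      rw [Finset.sup_lt_iff (lt_of_le_of_lt (Nat.zero_le _) hv.2)]
      intro b hb
      rcases Finset.mem_insert.1 hb with rfl | hb
      · exact hv.2
      · exact Fin.lt_def.1 (lt_of_le_of_ne (hle b (Finset.mem_of_mem_erase hb))
          (Finset.ne_of_mem_erase hb))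
    · intro w hw T hT hTd hTF
      rw [hFe] at hw hT hTF
      simp only [Finset.mem_union, Finset.mem_filter, Finset.mem_univ, true_and, not_or,
        not_and, not_lt] at hw
      by_contra hTC
      have hwT : w ∉ T := fun hwT => by
        have h1 := key T hTC hTd w hwT
        exact hw.1 (le_antisymm h1 (hw.2 hw.1) ▸ hf)
      exact hTF (Finset.eq_of_subset_of_card_le
        ((Finset.subset_insert_iff_of_notMem hwT).1 hT) (by omega))
    · intro T hT hTd hTF
      rw [hFe] at hTF
      obtain ⟨t, htT, htF⟩ := Finset.not_subset.1 fun hs : T ⊆ F =>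
        hTF (Finset.eq_of_subset_of_card_le hs (by omega))
      refine Finset.not_disjoint_iff.2 ⟨t, htT, ?_⟩
      simp only [Finset.mem_filter, Finset.mem_univ, true_and]
      exact ⟨htF, lt_of_le_of_ne (key T hT hTd t htT) fun h0 => htF (h0 ▸ hf)⟩

theorem isCocycleAcyclic_empty (hd : 0 < d) :
    IsCocycleAcyclic K d (∅ : Finset (Finset (Fin n))) :=
  isCocycleAcyclic_of_forall_sup_le hd _ ∅ rfl (by simp)

theorem UniformClutter.HasDegreeOne.exists_unique {C : UniformClutter n d} (hd : 0 < d)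
    (h : C.HasDegreeOne) : ∃ e : Finset (Fin n), ∃ f, f ∉ e ∧ e.card + 1 = d ∧
      insert f e ∈ C.circuits ∧ ∀ G ∈ C.circuits, e ⊆ G → G = insert f e := by
  obtain ⟨e, ⟨hec, -⟩, hdeg⟩ := h
  obtain ⟨F, hF⟩ := Finset.card_eq_one.1 hdeg
  have hFm : F ∈ C.circuits.filter fun F => e ⊆ F := hF ▸ Finset.mem_singleton_self F
  rw [Finset.mem_filter] at hFm
  have hFc := C.card_eq F hFm.1
  obtain ⟨f, hf, hfF⟩ := (Finset.exists_eq_insert_iff (s := e) (t := F)).2 ⟨hFm.2, by omega⟩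
  refine ⟨e, f, hf, by omega, hfF ▸ hFm.1, fun G hG heG => ?_⟩
  have : G ∈ C.circuits.filter fun F => e ⊆ F := Finset.mem_filter.2 ⟨hG, heG⟩
  rw [hF, Finset.mem_singleton] at this
  rw [this, hfF]

/-- Circuits are added in the reverse of an elimination order. When $F$ is added, $e\subset F$ lies
in no earlier circuit, so $Q$ may be the whole complement of $F$ and the condition on the remaining
`w` is void. -/
theorem isCocycleAcyclic_of_forall_hasDegreeOne (hd : 0 < d) (C : UniformClutter n d)
    (h : ∀ C' : UniformClutter n d, C'.circuits ⊆ C.circuits → C'.circuits.Nonempty →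
      C'.HasDegreeOne) : IsCocycleAcyclic K d C.circuits := by
  obtain ⟨k, hk⟩ : ∃ k, C.circuits.card = k := ⟨_, rfl⟩
  induction k generalizing C with
  | zero => rw [Finset.card_eq_zero.1 hk]; exact isCocycleAcyclic_empty hd
  | succ k ih =>
    obtain ⟨e, f, hf, he, hF, huniq⟩ :=
      (h C le_rfl (Finset.card_pos.1 (by omega))).exists_unique hd
    have hC := ih ⟨C.circuits.erase (insert f e), fun F hF =>
      C.card_eq F (Finset.mem_of_mem_erase hF)⟩
      (fun C' hC' => h C' (hC'.trans (Finset.erase_subset _ _)))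
      (by rw [Finset.card_erase_of_mem hF, hk]; rfl)
    have := hC.insert_circuit (Q := (insert f e)ᶜ) hf he (Finset.notMem_erase _ _) disjoint_compl_right
      (fun v _ hv => Finset.ne_of_mem_erase hv
        (huniq _ (Finset.mem_of_mem_erase hv) (Finset.subset_insert v e)))
      (fun w hw => absurd (by rw [Finset.union_compl]; exact Finset.mem_univ w) hw)
    rwa [Finset.insert_erase hF] at this

/-- For the last facet of the boundary of a simplex no face of degree one is available, but $Q=V^c$
works: the one vertex of $V\setminus F$ satisfies the condition on `w`, since all other facets are
present. -/
theorem isCocycleAcyclic_powersetCard (hd : 0 < d) {V : Finset (Fin n)} {F : Finset (Fin n)}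
    (hV : V.card = d + 1) (hF : F ∈ Finset.powersetCard d V)
    (h : IsCocycleAcyclic K d ((Finset.powersetCard d V).erase F)) :
    IsCocycleAcyclic K d (Finset.powersetCard d V) := by
  obtain ⟨hFV, hFd⟩ := Finset.mem_powersetCard.1 hF
  obtain ⟨f, hf⟩ := Finset.card_pos.1 (by omega : 0 < F.card)
  have hFe : insert f (F.erase f) = F := Finset.insert_erase hf
  have := h.insert_circuit (e := F.erase f) (f := f) (Q := Vᶜ) (Finset.notMem_erase f F)
    (by rw [Finset.card_erase_add_one hf, hFd]) (by rw [hFe]; exact Finset.notMem_erase _ _)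
    (by rw [hFe]; exact disjoint_compl_right.mono_left hFV)
    (fun v hv hvC => Finset.mem_compl.1 hv ((Finset.mem_powersetCard.1
      (Finset.mem_of_mem_erase hvC)).1 (Finset.mem_insert_self _ _)))
    (fun w hw T hT hTd hTF => by
      rw [hFe] at hw hT hTF
      simp only [Finset.mem_union, Finset.mem_compl, not_or, not_not] at hw
      exact Finset.mem_erase.2 ⟨hTF, Finset.mem_powersetCard.2
        ⟨hT.trans (Finset.insert_subset hw.2 hFV), hTd⟩⟩)
  rwa [hFe, Finset.insert_erase hF] at this

end Acyclicity

/-! ### From an acyclic cocycle complex to a minimal linear resolution. -/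

section Resolution

open MvPolynomial

variable {K : Type*} [Field K] {n d : ℕ}

/-- The part of the cocycle module supported on pairs `(W, T)` with `W` of size `d + i`. -/
def gradedCocycleModule (R : Type*) [CommRing R] (d : ℕ) (C : Finset (Finset (Fin n))) (i : ℕ) :
    Submodule R (Finset (Fin n) × Finset (Fin n) → R) where
  carrier := {y | y ∈ cocycleModule R d C ∧ ∀ p, p.1.card ≠ d + i → y p = 0}
  add_mem' := fun ha hb => ⟨add_mem ha.1 hb.1, fun p hp => by simp [ha.2 p hp, hb.2 p hp]⟩
  zero_mem' := ⟨zero_mem _, fun _ _ => rfl⟩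
  smul_mem' := fun c _ hy => ⟨Submodule.smul_mem _ c hy.1, fun p hp => by simp [hy.2 p hp]⟩

theorem mem_gradedCocycleModule_iff_coeff {C : Finset (Finset (Fin n))} {i : ℕ}
    {y : Finset (Fin n) × Finset (Fin n) → MvPolynomial (Fin n) K} :
    y ∈ gradedCocycleModule (MvPolynomial (Fin n) K) d C i ↔
      ∀ m, (fun p => coeff m (y p)) ∈ gradedCocycleModule K d C i := by
  constructor
  · exact fun h m => ⟨mem_cocycleModule_iff_coeff.1 h.1 m, fun p hp => by simp [h.2 p hp]⟩
  · exact fun h => ⟨mem_cocycleModule_iff_coeff.2 fun m => (h m).1, fun p hp => by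
      ext m; simpa using (h m).2 p hp⟩

theorem cocycleD_mem_graded {C : Finset (Finset (Fin n))} {i : ℕ}
    {y : Finset (Fin n) × Finset (Fin n) → MvPolynomial (Fin n) K}
    (hy : y ∈ gradedCocycleModule (MvPolynomial (Fin n) K) d C (i + 1)) :
    cocycleD y ∈ gradedCocycleModule (MvPolynomial (Fin n) K) d C i := by
  refine ⟨cocycleD_mem hy.1, fun p hp => ?_⟩
  unfold cocycleD
  split_ifs
  · refine Finset.sum_eq_zero fun w hw => ?_
    have h0 : y (insert w p.1, p.2) = 0 := hy.2 _ (by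
      rw [Finset.card_insert_of_notMem (Finset.mem_compl.1 hw)]
      omega)
    simp only [h0, mul_zero, smul_zero]
  · rfl

theorem cocycleD_eq_zero_of_graded_zero {C : Finset (Finset (Fin n))}
    {y : Finset (Fin n) × Finset (Fin n) → MvPolynomial (Fin n) K}
    (hy : y ∈ gradedCocycleModule (MvPolynomial (Fin n) K) d C 0) : cocycleD y = 0 := by
  ext1 ⟨W, T⟩
  by_contra h
  obtain ⟨h1, h2, -⟩ := (cocycleD_mem hy.1).1 W T h
  rw [cocycleD_apply _ h1] at h
  obtain ⟨w, hw, hne⟩ := Finset.exists_ne_zero_of_sum_ne_zero h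
  have h0 : y (insert w W, T) = 0 := hy.2 _ (by
    rw [Finset.card_insert_of_notMem (Finset.mem_compl.1 hw)]
    have := Finset.card_le_card h1
    omega)
  simp [h0] at hne

theorem cocycleAug_eq_zero_of_graded_succ {C : Finset (Finset (Fin n))} {i : ℕ}
    {y : Finset (Fin n) × Finset (Fin n) → MvPolynomial (Fin n) K}
    (hy : y ∈ gradedCocycleModule (MvPolynomial (Fin n) K) d C (i + 1)) : cocycleAug y = 0 := by
  refine Finset.sum_eq_zero fun T _ => ?_
  by_cases h : T.card = d
  · rw [hy.2 (T, T) (by simp only [h]; omega), mul_zero]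
  · rw [eq_zero_of_mem_cocycleModule hy.1 fun _ hc => absurd hc h, mul_zero]

theorem IsCocycleAcyclic.exists_graded {C : Finset (Finset (Fin n))} (hC : IsCocycleAcyclic K d C)
    {i : ℕ} {y : Finset (Fin n) × Finset (Fin n) → MvPolynomial (Fin n) K}
    (hy : y ∈ gradedCocycleModule (MvPolynomial (Fin n) K) d C i) (hdy : cocycleD y = 0)
    (hay : cocycleAug y = 0) :
    ∃ u ∈ gradedCocycleModule (MvPolynomial (Fin n) K) d C (i + 1), cocycleD u = y := by
  obtain ⟨u, hu, -, hdu⟩ := hC y hy.1 hdy hay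
  refine ⟨fun p => if p.1.card = d + (i + 1) then u p else 0,
    ⟨⟨fun W T h => hu.1 W T fun h0 => h (by simp [h0]), fun W U hU hc => ?_⟩,
      fun p hp => if_neg hp⟩, ?_⟩
  · by_cases h : W.card = d + (i + 1)
    · simp only [h, if_true]
      exact hu.2 W U hU hc
    · simp only [h, if_false, smul_zero, Finset.sum_const_zero]
  · ext1 ⟨W, T⟩
    by_cases hTW : T ⊆ W
    · rw [cocycleD_apply _ hTW]
      by_cases h : W.card = d + i
      · rw [← hdu, cocycleD_apply _ hTW]
        refine koszulD_congr fun w hw => if_pos ?_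
        rw [Finset.card_insert_of_notMem hw, h, add_assoc]
      · rw [hy.2 _ h]
        refine Finset.sum_eq_zero fun w hw => ?_
        have h0 : (insert w W).card ≠ d + (i + 1) := by
          rw [Finset.card_insert_of_notMem (Finset.mem_compl.1 hw)]
          omega
        simp only [h0, if_false, mul_zero, smul_zero]
    · rw [eq_zero_of_mem_cocycleModule hy.1 fun h => absurd h hTW]
      exact if_neg hTW

/-- `cocycleD` as a linear map. -/
noncomputable def cocycleDLinear (K : Type*) [Field K] (n : ℕ) :
    (Finset (Fin n) × Finset (Fin n) → MvPolynomial (Fin n) K) →ₗ[MvPolynomial (Fin n) K]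
      (Finset (Fin n) × Finset (Fin n) → MvPolynomial (Fin n) K) where
  toFun := cocycleD
  map_add' := cocycleD_add
  map_smul' := fun c y => by
    ext1 p
    simp only [cocycleD, koszulD, Pi.smul_apply, smul_eq_mul, RingHom.id_apply, mul_ite, mul_zero,
      Finset.mul_sum, mul_smul_comm, mul_left_comm c]

/-- `cocycleAug` as a linear map. -/
noncomputable def cocycleAugLinear (K : Type*) [Field K] (n : ℕ) :
    (Finset (Fin n) × Finset (Fin n) → MvPolynomial (Fin n) K) →ₗ[MvPolynomial (Fin n) K]
      MvPolynomial (Fin n) K where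
  toFun := cocycleAug
  map_add' := fun y z => by
    simp only [cocycleAug, Pi.add_apply, mul_add, Finset.sum_add_distrib]
  map_smul' := fun c y => by
    simp only [cocycleAug, Pi.smul_apply, smul_eq_mul, RingHom.id_apply, Finset.mul_sum,
      mul_left_comm c]

/-- `B` is the inclusion in coordinates and `A` a left inverse defined on the whole ambient space,
so a map between two such subspaces has a matrix of the form `A * D * B`. -/
theorem Submodule.exists_matrix_basis {P : Type*} [Fintype P] [DecidableEq P]
    (V : Submodule K (P → K)) :
    ∃ (r : ℕ) (B : Matrix P (Fin r) K) (A : Matrix (Fin r) P K), A * B = 1 ∧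
      (∀ c, B.mulVec c ∈ V) ∧ ∀ v ∈ V, B.mulVec (A.mulVec v) = v := by
  let b := Module.finBasis K V
  let g : (Fin (Module.finrank K V) → K) →ₗ[K] (P → K) :=
    V.subtype ∘ₗ b.equivFun.symm.toLinearMap
  have hg : Function.Injective g := V.subtype_injective.comp b.equivFun.symm.injective
  obtain ⟨h, hh⟩ := LinearMap.exists_leftInverse_of_injective g (LinearMap.ker_eq_bot.2 hg)
  refine ⟨_, LinearMap.toMatrix' g, LinearMap.toMatrix' h, ?_, fun c => ?_, fun v hv => ?_⟩
  · rw [← LinearMap.toMatrix'_comp, hh, LinearMap.toMatrix'_id]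
  · rw [LinearMap.toMatrix'_mulVec]
    exact (b.equivFun.symm c).2
  · rw [LinearMap.toMatrix'_mulVec, LinearMap.toMatrix'_mulVec]
    have : v = g (b.equivFun ⟨v, hv⟩) := by simp [g]
    rw [this, ← LinearMap.comp_apply h g, hh, LinearMap.id_apply]

theorem coeff_map_C_mulVec {P Q : Type*} [Fintype Q] (M : Matrix P Q K)
    (y : Q → MvPolynomial (Fin n) K) (m : Fin n →₀ ℕ) :
    (fun p => coeff m ((M.map C).mulVec y p)) = M.mulVec fun q => coeff m (y q) := by
  ext1 p
  simp [Matrix.mulVec, dotProduct, coeff_sum, coeff_C_mul]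

theorem isHomogeneous_map_C_mulVec {P Q : Type*} [Fintype Q] (M : Matrix P Q K)
    {y : Q → MvPolynomial (Fin n) K} {k : ℕ} (hy : ∀ q, (y q).IsHomogeneous k) (p : P) :
    ((M.map C).mulVec y p).IsHomogeneous k := by
  refine IsHomogeneous.sum _ _ _ fun q _ => ?_
  rw [← zero_add k]
  exact (isHomogeneous_C _ _).mul (hy q)

theorem isHomogeneous_cocycleD {y : Finset (Fin n) × Finset (Fin n) → MvPolynomial (Fin n) K}
    {k : ℕ} (hy : ∀ q, (y q).IsHomogeneous k) (p : Finset (Fin n) × Finset (Fin n)) :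
    (cocycleD y p).IsHomogeneous (1 + k) := by
  unfold cocycleD
  split_ifs
  · refine IsHomogeneous.sum _ _ _ fun w _ => ?_
    exact zsmul_mem (show _ ∈ homogeneousSubmodule (Fin n) K (1 + k) from
      (isHomogeneous_X K w).mul (hy _)) _
  · exact isHomogeneous_zero ..

theorem isHomogeneous_cocycleAug {C : Finset (Finset (Fin n))}
    {y : Finset (Fin n) × Finset (Fin n) → MvPolynomial (Fin n) K}
    (hyC : y ∈ cocycleModule (MvPolynomial (Fin n) K) d C)
    {k : ℕ} (hy : ∀ q, (y q).IsHomogeneous k) : (cocycleAug y).IsHomogeneous (d + k) := by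
  refine IsHomogeneous.sum _ _ _ fun T _ => ?_
  by_cases h : y (T, T) = 0
  · rw [h, mul_zero]; exact isHomogeneous_zero ..
  · refine IsHomogeneous.mul ?_ (hy _)
    have := IsHomogeneous.prod T (fun v => (X v : MvPolynomial (Fin n) K)) (fun _ => 1)
      fun v _ => isHomogeneous_X K v
    simpa [(hyC.1 T T h).2.1] using this

theorem UniformClutter.mem_circuitIdeal_iff (C : UniformClutter n d) {f : MvPolynomial (Fin n) K} :
    f ∈ C.circuitIdeal K ↔
      ∃ y ∈ gradedCocycleModule (MvPolynomial (Fin n) K) d C.circuits 0, cocycleAug y = f := by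
  constructor
  · intro hf
    have hle : C.circuitIdeal K ≤ Submodule.map (cocycleAugLinear K n)
        (gradedCocycleModule (MvPolynomial (Fin n) K) d C.circuits 0) := by
      refine Submodule.span_le.2 ?_
      rintro _ ⟨T, hT, rfl⟩
      simp only [UniformClutter.compl, Finset.mem_sdiff, Finset.mem_powersetCard] at hT
      refine ⟨Pi.single (T, T) 1, ⟨⟨fun W U h => ?_, fun W U hU hc => ?_⟩, fun p hp => ?_⟩, ?_⟩
      · have : (W, U) = (T, T) := by
          by_contra h0
          exact h (Pi.single_eq_of_ne h0 _)
        simp only [Prod.mk.injEq] at this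
        rw [this.1, this.2]
        exact ⟨le_rfl, hT.1.2, hT.2⟩
      · refine Finset.sum_eq_zero fun t ht => ?_
        rw [Pi.single_eq_of_ne, smul_zero]
        intro h0
        simp only [Prod.mk.injEq] at h0
        have := Finset.card_le_card hU
        rw [h0.1] at this
        omega
      · refine Pi.single_eq_of_ne ?_ _
        rintro rfl
        exact hp hT.1.2
      · change cocycleAug (Pi.single (T, T) (1 : MvPolynomial (Fin n) K)) = _
        rw [cocycleAug, Finset.sum_eq_single_of_mem T (Finset.mem_univ T) fun U _ hU => ?_,
          Pi.single_eq_same, mul_one]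
        rw [Pi.single_eq_of_ne, mul_zero]
        simp [hU]
    exact hle hf
  · rintro ⟨y, hy, rfl⟩
    rw [cocycleAug]
    refine Ideal.sum_mem _ fun T _ => ?_
    by_cases h : y (T, T) = 0
    · rw [h, mul_zero]; exact Ideal.zero_mem _
    · obtain ⟨-, h1, h2⟩ := hy.1.1 T T h
      exact Ideal.mul_mem_right _ _ (Ideal.subset_span ⟨T, by simp [UniformClutter.compl, h1, h2],
        rfl⟩)

/-- If the cocycle complex is acyclic, then it gives a minimal free resolution of the circuit
ideal. -/
theorem IsCocycleAcyclic.exists_resolution {C : UniformClutter n d}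
    (hC : IsCocycleAcyclic K d C.circuits) :
    ∃ R : MinimalGradedFreeResolution (C.circuitIdeal K), ∀ i k, R.deg i k = d + i := by
  choose r B A hAB hB hBA using fun i =>
    Submodule.exists_matrix_basis (gradedCocycleModule K d C.circuits i)
  let B' : (i : ℕ) → (Fin (r i) → MvPolynomial (Fin n) K) →ₗ[MvPolynomial (Fin n) K]
    (Finset (Fin n) × Finset (Fin n) → MvPolynomial (Fin n) K) :=
    fun i => ((B i).map MvPolynomial.C).mulVecLin
  let A' : (i : ℕ) → (Finset (Fin n) × Finset (Fin n) → MvPolynomial (Fin n) K)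
    →ₗ[MvPolynomial (Fin n) K] (Fin (r i) → MvPolynomial (Fin n) K) :=
    fun i => ((A i).map MvPolynomial.C).mulVecLin
  have hA'B' : ∀ i c, A' i (B' i c) = c := fun i c => by
    simp only [A', B', Matrix.mulVecLin_apply, Matrix.mulVec_mulVec]
    rw [← Matrix.map_mul, hAB, Matrix.map_one _ (map_zero _) (map_one _), Matrix.one_mulVec]
  have hB' : ∀ i c, B' i c ∈ gradedCocycleModule (MvPolynomial (Fin n) K) d C.circuits i := by
    intro i c
    rw [mem_gradedCocycleModule_iff_coeff]
    intro m
    simp only [B', Matrix.mulVecLin_apply, coeff_map_C_mulVec]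
    exact hB i _
  have hB'A' : ∀ i, ∀ y ∈ gradedCocycleModule (MvPolynomial (Fin n) K) d C.circuits i,
      B' i (A' i y) = y := by
    intro i y hy
    ext p m
    rw [mem_gradedCocycleModule_iff_coeff] at hy
    have h := congrFun (coeff_map_C_mulVec (B i) (A' i y) m) p
    simp only [A', Matrix.mulVecLin_apply, coeff_map_C_mulVec] at h
    rw [hBA i _ (hy m)] at h
    exact h
  have hsingle : ∀ i (b j : Fin (r i)),
      ((Pi.single b 1 : Fin (r i) → MvPolynomial (Fin n) K) j).IsHomogeneous 0 := by
    intro i b j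
    by_cases h : j = b
    · rw [h, Pi.single_eq_same]; exact isHomogeneous_one ..
    · rw [Pi.single_eq_of_ne h]; exact isHomogeneous_zero ..
  have hB'single : ∀ i b p, (B' i (Pi.single b 1) p).IsHomogeneous 0 := fun i b p =>
    isHomogeneous_map_C_mulVec (B i) (hsingle i b) p
  let D : (i : ℕ) → (Fin (r (i + 1)) → MvPolynomial (Fin n) K) →ₗ[MvPolynomial (Fin n) K]
    (Fin (r i) → MvPolynomial (Fin n) K) :=
    fun i => A' i ∘ₗ cocycleDLinear K n ∘ₗ B' (i + 1)
  have hB'D : ∀ i c, B' i (D i c) = cocycleD (B' (i + 1) c) := fun i c =>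
    hB'A' i _ (cocycleD_mem_graded (hB' (i + 1) c))
  -- `cocycleD` multiplies by variables while `A` and `B` have constant entries, so the
  -- differentials consist of linear forms. Both linearity and minimality come from this.
  have hD : ∀ i a b, (LinearMap.toMatrix' (D i) a b).IsHomogeneous 1 := by
    intro i a b
    rw [LinearMap.toMatrix'_apply]
    exact isHomogeneous_map_C_mulVec (A i) (isHomogeneous_cocycleD (hB'single (i + 1) b)) a
  have hgen : ∀ v : Fin (r 0) → MvPolynomial (Fin n) K,
      ∑ k, v k * cocycleAug (B' 0 (Pi.single k 1)) = cocycleAug (B' 0 v) := by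
    intro v
    have h := LinearMap.pi_apply_eq_sum_univ (cocycleAugLinear K n ∘ₗ B' 0) v
    refine Eq.trans (Finset.sum_congr rfl fun k _ => ?_) h.symm
    rw [smul_eq_mul]
    congr 4
    ext1 j
    simp [Pi.single_apply, eq_comm]
  have hsucc : ∀ i (c : Fin (r i) → MvPolynomial (Fin n) K), cocycleD (B' i c) = 0 →
      cocycleAug (B' i c) = 0 → ∃ c', D i c' = c := by
    intro i c hd ha
    obtain ⟨u, hu, hdu⟩ := hC.exists_graded (hB' i c) hd ha
    refine ⟨A' (i + 1) u, ?_⟩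
    rw [← hA'B' i (D i _), hB'D, hB'A' _ _ hu, hdu, hA'B']
  refine ⟨{
    rank := r
    deg := fun i _ => d + i
    gen := fun k => cocycleAug (B' 0 (Pi.single k 1))
    diff := fun i => LinearMap.toMatrix' (D i)
    gen_homogeneous := fun k => isHomogeneous_cocycleAug (hB' 0 _).1 (hB'single 0 k)
    diff_homogeneous := ?_
    span_gen := ?_
    exact_zero := ?_
    exact_succ := ?_
    minimal := ?_ }, fun _ _ => rfl⟩
  · intro i a b m hm
    have h : m.degree = 1 := by
      rw [Finsupp.degree_eq_weight_one]
      exact hD i a b (mem_support_iff.1 hm)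
    rw [h]
    omega
  · refine le_antisymm (Ideal.span_le.2 ?_) fun f hf => ?_
    · rintro _ ⟨k, rfl⟩
      exact C.mem_circuitIdeal_iff.2 ⟨_, hB' 0 _, rfl⟩
    · obtain ⟨y, hy, rfl⟩ := C.mem_circuitIdeal_iff.1 hf
      rw [← hB'A' 0 y hy, ← hgen]
      exact sum_mem fun k _ => Ideal.mul_mem_left _ _ (Ideal.subset_span ⟨k, rfl⟩)
  · intro c
    simp only [LinearMap.toMatrix'_mulVec, hgen, Set.mem_range]
    refine ⟨fun h => hsucc 0 c (cocycleD_eq_zero_of_graded_zero (hB' 0 c)) h, ?_⟩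
    rintro ⟨c', rfl⟩
    rw [hB'D]
    exact cocycleAug_cocycleD (hB' 1 c').1
  · intro i c
    simp only [LinearMap.toMatrix'_mulVec, Set.mem_range]
    constructor
    · intro h
      refine hsucc (i + 1) c ?_ (cocycleAug_eq_zero_of_graded_succ (hB' (i + 1) c))
      rw [← hB'D, h, map_zero]
    · rintro ⟨c', rfl⟩
      rw [← hA'B' i (D i _), hB'D, hB'D, cocycleD_cocycleD, map_zero]
  · intro i a b
    by_contra h
    have := hD i a b (d := 0) h
    simp at this

theorem UniformClutter.le_degree_of_mem_circuitIdeal (C : UniformClutter n d)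
    {f : MvPolynomial (Fin n) K} (hf : f ∈ C.circuitIdeal K) {m : Fin n →₀ ℕ}
    (hm : m ∈ f.support) : d ≤ m.degree := by
  have hI : C.circuitIdeal K = Ideal.span ((fun s => monomial s (1 : K)) ''
      ((fun T : Finset (Fin n) => ∑ v ∈ T, Finsupp.single v 1) '' (C.compl.circuits : Set _))) := by
    rw [Set.image_image, UniformClutter.circuitIdeal, UniformClutter.ideal]
    congr 1
    ext g
    simp only [monomial_sum_one, Set.mem_ofPred_eq, Set.mem_image, Finset.mem_coe, X, eq_comm]
  rw [hI, mem_ideal_span_monomial_image] at hf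
  obtain ⟨_, ⟨T, hT, rfl⟩, hle⟩ := hf m hm
  have h := Finsupp.degree_mono hle
  simpa [C.compl.card_eq T hT] using h

/-- All shifts in position $i$ are $d+i$, so $j-i=d$ throughout, and this value occurs at $i=0$
because a nonzero ideal needs a generator. -/
theorem IsCocycleAcyclic.hasLinearResolution {C : UniformClutter n d}
    (hC : IsCocycleAcyclic K d C.circuits) : HasLinearResolution d (C.circuitIdeal K) := by
  rw [HasLinearResolution, or_iff_not_imp_left]
  intro hne
  obtain ⟨R, hR⟩ := hC.exists_resolution
  have hrank : Nonempty (Fin (R.rank 0)) := by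
    by_contra h
    rw [not_nonempty_iff] at h
    apply hne
    rw [← R.span_gen, Set.range_eq_empty, Ideal.span_empty]
  obtain ⟨k⟩ := hrank
  refine ⟨⟨R, fun x => ?_, fun x hx => ?_⟩, ?_, ?_⟩
  · rintro ⟨i, j, hb, rfl⟩
    obtain ⟨a, ha⟩ := Finset.card_ne_zero.1 hb
    rw [Finset.mem_filter, hR] at ha
    rw [← ha.2]
    push_cast
    omega
  · refine hx ⟨0, d, ?_, by simp⟩
    exact Finset.card_ne_zero.2 ⟨k, by simp [hR]⟩
  · obtain ⟨T, hT⟩ : C.compl.circuits.Nonempty := by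
      by_contra h
      rw [Finset.not_nonempty_iff_eq_empty] at h
      apply hne
      simp [UniformClutter.circuitIdeal, UniformClutter.ideal, h]
    refine ⟨∏ v ∈ T, X v, Ideal.subset_span ⟨T, hT, rfl⟩,
      Finset.prod_ne_zero_iff.2 fun v _ => X_ne_zero v, ?_⟩
    have := IsHomogeneous.prod T (fun v => (X v : MvPolynomial (Fin n) K)) (fun _ => 1)
      fun v _ => isHomogeneous_X K v
    simpa [C.compl.card_eq T hT] using this
  · rintro i ⟨f, hf, hf0, hfi⟩
    obtain ⟨m, hm⟩ := support_nonempty.2 hf0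
    have h1 : m.degree = i := by
      rw [Finsupp.degree_eq_weight_one]
      exact hfi (mem_support_iff.1 hm)
    rw [← h1]
    exact C.le_degree_of_mem_circuitIdeal hf hm

end Resolution

/-! ### Dimension of the clique complex and conclusion. -/

namespace UniformClutter

variable {K : Type*} [Field K] {n d : ℕ}

/-- A circuit is a clique, which bounds the dimension below by $d-1$; without circuits the dimension
is smaller than $d-1$. A larger dimension gives a clique with at least $d+1$ elements. -/
theorem exists_clique_of_complexDim_ne (C : UniformClutter n d)
    (hne : C.circuits.Nonempty) (h : complexDim C.cliqueComplex ≠ (d : ℤ) - 1) :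
    ∃ V : Finset (Fin n), V.card = d + 1 ∧ Finset.powersetCard d V ⊆ C.circuits := by
  obtain ⟨F, hF⟩ := hne
  have hFd := C.card_eq F hF
  have hFm : F ∈ C.cliqueComplex := by
    simp only [cliqueComplex, Finset.mem_filter, Finset.mem_univ, true_and]
    refine ⟨F, fun G hG hGd => ?_, le_rfl⟩
    rwa [Finset.eq_of_subset_of_card_le hG (by omega)]
  have h1 : d ≤ C.cliqueComplex.sup Finset.card :=
    hFd.symm.le.trans (Finset.le_sup (f := Finset.card) hFm)
  have h2 : d < C.cliqueComplex.sup Finset.card := by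
    refine lt_of_le_of_ne h1 fun h0 => h ?_
    rw [complexDim, ← h0]
  obtain ⟨G, hG, hGd⟩ := (Finset.lt_sup_iff).1 h2
  simp only [cliqueComplex, Finset.mem_filter, Finset.mem_univ, true_and] at hG
  obtain ⟨W, hW, hGW⟩ := hG
  obtain ⟨V, hVG, hV⟩ := Finset.exists_subset_card_eq (show d + 1 ≤ G.card from hGd)
  refine ⟨V, hV, fun T hT => ?_⟩
  rw [Finset.mem_powersetCard] at hT
  exact hW T (hT.1.trans (hVG.trans hGW)) hT.2

/-- Each $(d-1)$-subset of $V$ misses two elements of $V$ and so lies in two circuits. -/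
theorem not_hasDegreeOne_of_circuits_eq (C : UniformClutter n d) (hd : 0 < d)
    {V : Finset (Fin n)} (hV : V.card = d + 1) (h : C.circuits = Finset.powersetCard d V) :
    ¬ C.HasDegreeOne := by
  intro h1
  obtain ⟨e, f, hf, he, hF, huniq⟩ := h1.exists_unique hd
  rw [h, Finset.mem_powersetCard] at hF
  obtain ⟨v, hvV, hv⟩ := Finset.exists_mem_notMem_of_card_lt_card
    (show (insert f e).card < V.card by omega)
  rw [Finset.mem_insert, not_or] at hv
  have h2 := huniq (insert v e) (by
    rw [h, Finset.mem_powersetCard, Finset.card_insert_of_notMem hv.2]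
    exact ⟨Finset.insert_subset hvV ((Finset.subset_insert f e).trans hF.1), he⟩)
    (Finset.subset_insert v e)
  have h3 : v ∈ insert f e := h2 ▸ Finset.mem_insert_self v e
  rw [Finset.mem_insert] at h3
  exact h3.elim hv.1 hv.2

theorem IsTree.complexDim_eq {C : UniformClutter n d} (hd : 0 < d) (h : C.IsTree) :
    complexDim C.cliqueComplex = (d : ℤ) - 1 := by
  by_contra hne
  obtain ⟨V, hV, hVC⟩ := C.exists_clique_of_complexDim_ne h.1 hne
  refine not_hasDegreeOne_of_circuits_eq
    ⟨Finset.powersetCard d V, fun F hF => (Finset.mem_powersetCard.1 hF).2⟩ hd hV rfl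
    (h.2.2 _ hVC ?_)
  exact Finset.powersetCard_nonempty.2 (by omega)

theorem hasLinearResolution_of_forall_hasDegreeOne (hd : 0 < d) (C : UniformClutter n d)
    (h : ∀ C' : UniformClutter n d, C'.circuits ⊆ C.circuits → C'.circuits.Nonempty →
      C'.HasDegreeOne) : HasLinearResolution d (C.circuitIdeal K) :=
  (isCocycleAcyclic_of_forall_hasDegreeOne hd C h).hasLinearResolution

theorem IsAlmostTreeWide.complexDim_eq {C : UniformClutter n d} (hd : 0 < d)
    (h : C.IsAlmostTreeWide K) : complexDim C.cliqueComplex = (d : ℤ) - 1 := by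
  by_contra hne
  -- The empty clutter is excluded because its circuit ideal has a linear resolution.
  have hC : C.circuits.Nonempty := by
    by_contra h0
    rw [Finset.not_nonempty_iff_eq_empty] at h0
    refine h.1 (hasLinearResolution_of_forall_hasDegreeOne hd C fun C' hC' hne' => ?_)
    rw [h0, Finset.subset_empty] at hC'
    exact absurd hC' hne'.ne_empty
  obtain ⟨V, hV, hVC⟩ := C.exists_clique_of_complexDim_ne hC hne
  obtain ⟨F, hF⟩ : (Finset.powersetCard d V).Nonempty :=
    Finset.powersetCard_nonempty.2 (by omega)
  -- Were it a proper subclutter, the boundary of the simplex would have a submaximal circuit of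
  -- degree one.
  have hEq : Finset.powersetCard d V = C.circuits := by
    by_contra hVne
    exact not_hasDegreeOne_of_circuits_eq
      ⟨Finset.powersetCard d V, fun F hF => (Finset.mem_powersetCard.1 hF).2⟩ hd hV rfl
      (h.2 _ (hVC.ssubset_of_ne hVne) ⟨F, hF⟩)
  have hac : IsCocycleAcyclic K d ((Finset.powersetCard d V).erase F) := by
    rw [hEq] at hF ⊢
    refine isCocycleAcyclic_of_forall_hasDegreeOne hd
      ⟨C.circuits.erase F, fun G hG => C.card_eq G (Finset.mem_of_mem_erase hG)⟩
      fun C' hC' hne' => h.2 C' (hC'.trans_ssubset (Finset.erase_ssubset hF)) hne'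
  have := isCocycleAcyclic_powersetCard hd hV hF hac
  rw [hEq] at this
  exact h.1 this.hasLinearResolution

theorem IsTree.hasDegreeOne {C : UniformClutter n d} (h : C.IsTree) : C.HasDegreeOne :=
  h.2.2 C le_rfl h.1

theorem IsAlmostTree.isAlmostTreeWide {C : UniformClutter n d} (h : C.IsAlmostTree K) :
    C.IsAlmostTreeWide K :=
  ⟨h.1, fun C' hC' hne => (h.2 C' hC' hne).hasDegreeOne⟩

theorem IsAlmostTreeWide.isMinimal {C : UniformClutter n d} (hd : 0 < d)
    (h : C.IsAlmostTreeWide K) : C.IsMinimal K :=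
  ⟨⟨h.1, fun C' hC' => hasLinearResolution_of_forall_hasDegreeOne hd C' fun C'' hC'' hne =>
    h.2 C'' (lt_of_le_of_lt hC'' hC') hne⟩, h.complexDim_eq hd⟩

end UniformClutter

theorem mainTheorem9 (K : Type*) [Field K] (d : ℕ) (hd : 0 < d) :
    (∀ (n : ℕ) (C : UniformClutter n d),
      C.IsTree ∨ C.IsAlmostTree K ∨ C.IsAlmostTreeWide K →
        complexDim C.cliqueComplex = (d : ℤ) - 1) ∧
    UniformClutter.almostTreeClass K d ⊆ UniformClutter.minimalClass K d ∧
    UniformClutter.almostTreeWideClass K d ⊆ UniformClutter.minimalClass K d := by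
  refine ⟨fun n C h => ?_, fun C hC => ?_, fun C hC => ?_⟩
  · rcases h with h | h | h
    · exact h.complexDim_eq hd
    · exact h.isAlmostTreeWide.complexDim_eq hd
    · exact h.complexDim_eq hd
  · exact (UniformClutter.IsAlmostTree.isAlmostTreeWide hC).isMinimal hd
  · exact UniformClutter.IsAlmostTreeWide.isMinimal hd hC
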